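/- For $t\in\mathbb R$ let $\ln^+t=\max\{\ln t,1\}$. For $B\in\mathbb N$, $B\ge 1$, define $\lceil t\rfloor_B$ to be an integer nearest to $t$ if $|t|\le B$ (ties are broken by an arbitrary fixed rule), and $B\cdot\mathrm{sign}(t)$ otherwise; for vectors it is applied entrywise. Let $m<n$ be natural numbers and let $K\ge 2$ be a real parameter. On input a matrix $A\in\mathbb R^{m\times n}$ with independent standard normal entries, the kernel rounding algorithm samples a uniformly random (Haar distributed) unit vector $u$ of $\ker(A)$ and, independently, a chi-squared random variable $s$ with $n$ degrees of freedom, sets $$x=\sqrt{s}\cdot\frac{B}{\sqrt{4K\ln^+B}}\cdot u,$$ and outputs $z=\lceil x\rfloor_B$. **Theorem 4.5.** There are universal constants $C,C',c>0$, and for every real $K\ge2$ a constant $c_K>0$ depending only on $K$, such that for all natural numbers $m<n$ and $B\ge1$ and every tie-breaking rule the following holds. The output $z$ always lies in $([-B,B]\cap\mathbb Z)^n$. Write $$\delta=\min\Bigl\{C'\,2^{-c\,n(K\ln B)^2/B^4},\ 2nB^{-K}\Bigr\}.$$ Then, over the choice of $A$, $u$ and $s$, 1. except with probability at most $2^{-cm}+\delta$,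 $$\|Az\|_2\le C\,\frac{\sqrt{mK\ln^+B}}{B}\,\|z\|_2;$$ 2. except with probability at most $2^{-c_Km}+\delta$, the vector $z$ is nonzero and $$\frac{\|Az\|_2}{\|z\|_2}\le C\,\frac{\sqrt{mK\ln^+B}}{B}.$$ -/

import Mathlib

open MeasureTheory ProbabilityTheory

noncomputable section

/-- `ln⁺ t = max {ln t, 1}`. -/
def lnPlus (t : ℝ) : ℝ := max (Real.log t) 1

/-- `r` rounds every real number to a nearest integer, ties being broken arbitrarily. -/
def IsNearestInteger (r : ℝ → ℤ) : Prop := ∀ t : ℝ, |t - (r t : ℝ)| ≤ 1 / 2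

/-- The rounding function with clipping: `r t` if `|t| ≤ B`, and `B * sign t` otherwise. -/
def clipRound (r : ℝ → ℤ) (B : ℕ) (t : ℝ) : ℤ :=
  if |t| ≤ (B : ℝ) then r t else if 0 < t then (B : ℤ) else -(B : ℤ)

/-- The law of an `m × n` matrix with independent standard normal entries. -/
def gaussianMatrix (m n : ℕ) : Measure (Fin m → Fin n → ℝ) :=
  Measure.pi fun _ => Measure.pi fun _ => gaussianReal 0 1

/-- The chi-squared distribution with `n` degrees of freedom. -/
def chiSquared (n : ℕ) : Measure ℝ :=
  (Measure.pi fun _ : Fin n => gaussianReal 0 1).map fun v => ∑ i, v i ^ 2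

/-- The kernel of `A`, as a subspace of Euclidean space. -/
def kerSpace {m n : ℕ} (A : Fin m → Fin n → ℝ) : Submodule ℝ (EuclideanSpace ℝ (Fin n)) :=
  LinearMap.ker (Matrix.toEuclideanLin (Matrix.of A))

/-- The uniform (rotation invariant) probability measure on the unit sphere of a nonzero
subspace `E`: the normalized surface measure induced by the Lebesgue (Haar) measure of `E`. -/
def uniformSphere {n : ℕ} (E : Submodule ℝ (EuclideanSpace ℝ (Fin n))) :
    Measure (Metric.sphere (0 : E) 1) :=
  let σ := ((stdOrthonormalBasis ℝ E).toBasis.addHaar).toSphere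
  (σ Set.univ)⁻¹ • σ

/-- The internal randomness of the kernel rounding algorithm on input `A`: a pair `(s, u)` of
independent random variables, where `s` is chi-squared with `n` degrees of freedom and `u` is a
uniformly random unit vector of the kernel of `A`. -/
def kernelRoundCoins {m n : ℕ} (A : Fin m → Fin n → ℝ) :
    Measure (ℝ × Metric.sphere (0 : kerSpace A) 1) :=
  (chiSquared n).prod (uniformSphere (kerSpace A))

/-- The vector of the kernel of `A` that gets rounded: the direction `u`, scaled to length
`√s * B / √(4 K ln⁺ B)`. -/
def kernelVector {m n : ℕ} (K : ℝ) (B : ℕ) (A : Fin m → Fin n → ℝ)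
    (w : ℝ × Metric.sphere (0 : kerSpace A) 1) : EuclideanSpace ℝ (Fin n) :=
  (√w.1 * ((B : ℝ) / √(4 * K * lnPlus B))) • ((w.2 : kerSpace A) : EuclideanSpace ℝ (Fin n))

/-- The output `z` of the kernel rounding algorithm on input `A` with internal randomness `w`. -/
def kernelRound {m n : ℕ} (r : ℝ → ℤ) (K : ℝ) (B : ℕ) (A : Fin m → Fin n → ℝ)
    (w : ℝ × Metric.sphere (0 : kerSpace A) 1) : Fin n → ℤ :=
  fun i => clipRound r B (kernelVector K B A w i)

/-- The probability, over a Gaussian matrix `A` and the internal randomness of the kernel rounding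
algorithm, that the input `A` and the output `z` satisfy `bad A z`. -/
def kernelRoundProb {m n : ℕ} (r : ℝ → ℤ) (K : ℝ) (B : ℕ)
    (bad : (Fin m → Fin n → ℝ) → (Fin n → ℤ) → Prop) : ENNReal :=
  ∫⁻ A, kernelRoundCoins A {w | bad A (kernelRound r K B A w)} ∂(gaussianMatrix m n)

/-- The Euclidean norm of an integer vector. -/
def vecNorm {n : ℕ} (z : Fin n → ℤ) : ℝ := √(∑ i, (z i : ℝ) ^ 2)

/-- The Euclidean norm of `A z` for an integer vector `z`. -/
def imageNorm {m n : ℕ} (A : Fin m → Fin n → ℝ) (z : Fin n → ℤ) : ℝ :=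
  √(∑ i, (∑ j, A i j * (z j : ℝ)) ^ 2)

end

/-!
Write `V = ℝⁿ`, let `A` be a Gaussian matrix, described by its rows in `V`, and let `g` be the
vector `√s • u` of its kernel, so that the algorithm rounds `a • g` with
`a = B / √(4 K ln⁺ B)`. Two facts about the joint law of `A` and `g` carry the proof.

* The kernel vector `g` is a standard Gaussian vector. The uniform measure on the unit sphere of
  `ker A` is the law of the normalized projection `kernelDir` of an independent Gaussian vector
  (`map_starProjection_uniformSphere`); it is then rotation invariant jointly with `A`, and a
  rotation invariant law is determined by the law of the norm (`lintegral_eq_polar`).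

* Conditionally on `g`, any vector `b g` determined by `g` satisfies `‖A (b g)‖ ≤ O(√m) ‖b g‖`
  except with probability `4⁻ᵐ` (`kernelVectorLaw_stretch_euclidean_le`). Conditioning `A` on `g`
  does not give a Gaussian matrix orthogonal to `g`, so the conditional law is not computed.
  Instead, averaging over the rotation group shows that `(A, g)` can be sampled by first drawing
  the direction of `g` and then moving an independent copy of `A` by a reflection which takes its
  own kernel direction to the drawn one (`lintegral_kernelDir_eq`). The law of the moved matrix is
  invariant under rotations fixing `g`, so `b g` may be replaced by a Gaussian vector independent
  of everything, for which the bound is elementary (`gaussianFrame_exchange_le`).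

If `a < 300`, the second fact applied to the rounded vector `z` itself is enough, since the bound
to be proved allows a ratio `‖A z‖ / ‖z‖` of order `√m / a`. In this range `z` may vanish, with
probability at most `pᵐ` for some `p < 1` depending on `K`; because the second fact holds
conditionally, the two failures combine to a probability `p + q - p q` with `q = 4⁻ᵐ`, which stays
exponentially small in `m` however close to `1` the number `p` is.

If `a ≥ 300`, the second fact is applied to the rounding error `b g = z - a • g`, which has the
same image as `z` under `A`. Its norm is at most `3 √n` except with the probability bounded by
`clipBound`, where an exponential moment controls the coordinates which are clipped, and
`‖z‖ ≥ a √n / 100` except with probability `16⁻ⁿ`.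
-/

noncomputable section

/-! ### Reflections exchanging two vectors -/

section Exchange

open scoped RealInnerProductSpace

variable {V : Type*} [NormedAddCommGroup V] [InnerProductSpace ℝ V]

/-- The reflection which exchanges two vectors of the same norm. It is the identity if the two
vectors are equal. -/
def exchange (u v : V) : V ≃ₗᵢ[ℝ] V := (ℝ ∙ (u - v))ᗮ.reflection

lemma exchange_apply (u v x : V) :
    exchange u v x = x - (2 * (⟪u - v, x⟫ / ‖u - v‖ ^ 2)) • (u - v) := by
  rw [exchange, Submodule.reflection_orthogonal_apply, Submodule.reflection_singleton_apply]
  rw [neg_sub, mul_smul, two_smul, two_smul]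
  simp

lemma exchange_left {u v : V} (h : ‖u‖ = ‖v‖) : exchange u v u = v :=
  Submodule.reflection_sub h

lemma exchange_exchange (u v x : V) : exchange u v (exchange u v x) = x := by
  rw [exchange]; exact Submodule.reflection_reflection _ x

lemma exchange_right {u v : V} (h : ‖u‖ = ‖v‖) : exchange u v v = u := by
  have := exchange_exchange u v u
  rwa [exchange_left h] at this

lemma inner_exchange (u v x y : V) : ⟪exchange u v x, y⟫ = ⟪x, exchange u v y⟫ := by
  rw [← (exchange u v).inner_map_map x, exchange_exchange]

lemma exchange_map (S : V ≃ₗᵢ[ℝ] V) (u v x : V) :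
    exchange (S u) (S v) (S x) = S (exchange u v x) := by
  simp only [exchange_apply, ← map_sub, S.inner_map_map, S.norm_map]
  simp

lemma measurable_exchange_comp [MeasurableSpace V] [BorelSpace V] [SecondCountableTopology V]
    {α : Type*} [MeasurableSpace α] {f g h : α → V}
    (hf : Measurable f) (hg : Measurable g) (hh : Measurable h) :
    Measurable fun a => exchange (f a) (g a) (h a) := by
  simp only [exchange_apply]
  fun_prop

end Exchange

/-! ### The rotation group and its Haar measure -/

section Rotations

open scoped RealInnerProductSpace

variable {V : Type*} [NormedAddCommGroup V] [InnerProductSpace ℝ V] [FiniteDimensional ℝ V]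
  [CompleteSpace V]

/-- The group of linear isometries of `V`, realised inside the algebra of continuous linear maps,
where it inherits its topology and its Borel structure. -/
abbrev Rotation (V : Type*) [NormedAddCommGroup V] [InnerProductSpace ℝ V] [CompleteSpace V] :
    Type _ :=
  unitary (V →L[ℝ] V)

instance compactSpace_rotation : CompactSpace (Rotation V) := by
  refine isCompact_iff_compactSpace.1 (Metric.isCompact_of_isClosed_isBounded ?_ ?_)
  · have h : ((unitary (V →L[ℝ] V) : Submonoid _) : Set (V →L[ℝ] V)) =
        {u | star u * u = 1} ∩ {u | u * star u = 1} := by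
      ext u
      simp [Unitary.mem_iff]
    rw [h]
    exact (isClosed_eq (by fun_prop) continuous_const).inter
      (isClosed_eq (by fun_prop) continuous_const)
  · refine (Metric.isBounded_closedBall (x := (0 : V →L[ℝ] V)) (r := 1)).subset fun u hu => ?_
    rw [mem_closedBall_zero_iff]
    refine ContinuousLinearMap.opNorm_le_bound _ zero_le_one fun x => ?_
    rw [one_mul, ContinuousLinearMap.norm_map_of_mem_unitary hu]

/-- The Haar probability measure of the rotation group. -/
def rotationHaar (V : Type*) [NormedAddCommGroup V] [InnerProductSpace ℝ V]
    [FiniteDimensional ℝ V] [CompleteSpace V] : Measure (Rotation V) :=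
  Measure.haarMeasure ⊤

instance isProbabilityMeasure_rotationHaar : IsProbabilityMeasure (rotationHaar V) :=
  ⟨Measure.haarMeasure_self (K₀ := (⊤ : TopologicalSpace.PositiveCompacts (Rotation V)))⟩

instance isMulLeftInvariant_rotationHaar : (rotationHaar V).IsMulLeftInvariant := by
  unfold rotationHaar; infer_instance

/-- The inverse of a rotation, as a linear isometry equivalence. With the inverse, left invariance
of the Haar measure lets an isometry act on the argument first. -/
def rotInv (O : Rotation V) : V ≃ₗᵢ[ℝ] V := (Unitary.linearIsometryEquiv O).symm

/-- Left invariance of the Haar measure, in terms of inverse rotations. -/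
lemma lintegral_rotationHaar_rotInv_trans (S : V ≃ₗᵢ[ℝ] V) (F : (V ≃ₗᵢ[ℝ] V) → ENNReal) :
    ∫⁻ O, F (S.trans (rotInv O)) ∂(rotationHaar V) = ∫⁻ O, F (rotInv O) ∂(rotationHaar V) := by
  have key := lintegral_mul_left_eq_self (μ := rotationHaar V) (fun O => F (rotInv O))
    (Unitary.linearIsometryEquiv.symm S.symm)
  rw [← key]
  refine lintegral_congr fun O => ?_
  congr 1
  ext x
  simp [rotInv, map_mul]
  rfl

/-- The image of a vector under a random rotation depends on its norm only. -/
lemma lintegral_rotInv_eq {u v : V} (h : ‖u‖ = ‖v‖) (F : V → ENNReal) :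
    ∫⁻ O, F (rotInv O u) ∂(rotationHaar V) = ∫⁻ O, F (rotInv O v) ∂(rotationHaar V) := by
  rw [← lintegral_rotationHaar_rotInv_trans (exchange u v) fun T => F (T u)]
  simp [exchange_left h]

variable [MeasurableSpace V] [BorelSpace V]

lemma measurable_rotInv : Measurable fun p : Rotation V × V => rotInv p.1 p.2 := by
  have : Continuous fun p : Rotation V × V => rotInv p.1 p.2 := by
    change Continuous fun p : Rotation V × V => (star p.1.1) p.2
    fun_prop
  exact this.measurable

-- From here on, only the measurability of `rotInv` and the invariance of the Haar measure matter.
attribute [irreducible] rotInv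

lemma measurable_rotInv_comp {α : Type*} [MeasurableSpace α] {f : α → Rotation V} {g : α → V}
    (hf : Measurable f) (hg : Measurable g) : Measurable fun a => rotInv (f a) (g a) := by
  have h : Measurable fun a => (f a, g a) := hf.prodMk hg
  exact measurable_rotInv.comp h

/-- Polar decomposition of a rotation invariant measure: the direction of its vectors is that of a
randomly rotated unit vector, independent of the norm. -/
lemma lintegral_eq_polar (μ : Measure V) [SFinite μ] (hμ : ∀ S : V ≃ₗᵢ[ℝ] V, μ.map S = μ)
    {e : V} (he : ‖e‖ = 1) {f : V → ENNReal} (hf : Measurable f) :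
    ∫⁻ x, f x ∂μ = ∫⁻ x, ∫⁻ O, f (‖x‖ • rotInv O e) ∂(rotationHaar V) ∂μ := by
  have h1 : ∀ O : Rotation V, ∫⁻ x, f (rotInv O x) ∂μ = ∫⁻ x, f x ∂μ := fun O => by
    conv_rhs => rw [← hμ (rotInv O)]
    rw [lintegral_map hf (rotInv O).continuous.measurable]
  calc ∫⁻ x, f x ∂μ = ∫⁻ O, ∫⁻ x, f (rotInv O x) ∂μ ∂(rotationHaar V) := by simp [h1]
    _ = ∫⁻ x, ∫⁻ O, f (rotInv O x) ∂(rotationHaar V) ∂μ :=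
      lintegral_lintegral_swap (hf.comp measurable_rotInv).aemeasurable
    _ = _ := lintegral_congr fun x => by
      rw [lintegral_rotInv_eq (v := ‖x‖ • e) (by simp [norm_smul, he])]
      simp

/-- A rotation invariant probability measure on the unit sphere is unique. -/
lemma eq_of_map_isometry_eq (μ ν : Measure V) [IsProbabilityMeasure μ] [IsProbabilityMeasure ν]
    (hμ : ∀ S : V ≃ₗᵢ[ℝ] V, μ.map S = μ) (hν : ∀ S : V ≃ₗᵢ[ℝ] V, ν.map S = ν)
    (hμ1 : ∀ᵐ x ∂μ, ‖x‖ = 1) (hν1 : ∀ᵐ x ∂ν, ‖x‖ = 1) : μ = ν := by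
  obtain ⟨e, he⟩ := hμ1.exists
  have key : ∀ ρ : Measure V, IsProbabilityMeasure ρ → (∀ S : V ≃ₗᵢ[ℝ] V, ρ.map S = ρ) →
      (∀ᵐ x ∂ρ, ‖x‖ = 1) → ∀ s, MeasurableSet s →
      ρ s = ∫⁻ O, s.indicator 1 (rotInv O e) ∂(rotationHaar V) := by
    intro ρ _ hρ hρ1 s hs
    rw [← lintegral_indicator_one hs,
      lintegral_eq_polar ρ hρ he (measurable_one.indicator hs)]
    have : ∀ᵐ x ∂ρ, ∫⁻ O, s.indicator (1 : V → ENNReal) (‖x‖ • rotInv O e) ∂(rotationHaar V) =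
        ∫⁻ O, s.indicator 1 (rotInv O e) ∂(rotationHaar V) := by
      filter_upwards [hρ1] with x hx
      simp [hx]
    rw [lintegral_congr_ae this]
    simp
  ext s hs
  rw [key μ inferInstance hμ hμ1 s hs, key ν inferInstance hν hν1 s hs]

end Rotations

/-! ### Standard Gaussian vectors and the uniform measure on a sphere -/

section GaussianVectors

open scoped RealInnerProductSpace Pointwise

variable {V : Type*} [NormedAddCommGroup V] [InnerProductSpace ℝ V] [FiniteDimensional ℝ V]
  [MeasurableSpace V] [BorelSpace V]

lemma map_inner_stdGaussian {e : V} (he : ‖e‖ = 1) :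
    (stdGaussian V).map (fun x => ⟪e, x⟫) = gaussianReal 0 1 := by
  have : IsProbabilityMeasure ((stdGaussian V).map fun x => ⟪e, x⟫) :=
    Measure.isProbabilityMeasure_map (by fun_prop)
  apply Measure.ext_of_charFun
  ext t
  rw [charFun_gaussianReal, charFun_apply_real, integral_map (by fun_prop) (by fun_prop)]
  have h := charFun_stdGaussian (t • e)
  rw [charFun_apply] at h
  simp only [real_inner_smul_right, real_inner_comm e] at h
  convert h using 2
  · ext x; simp
  · rw [norm_smul, he, mul_one, Real.norm_eq_abs, ← Complex.ofReal_pow |t|, sq_abs]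
    simp [neg_div]

lemma stdGaussian_ae_ne_zero [Nontrivial V] : ∀ᵐ x ∂(stdGaussian V), x ≠ 0 := by
  obtain ⟨e, he⟩ := exists_norm_eq V zero_le_one
  have h : ∀ᵐ x ∂((stdGaussian V).map fun x => ⟪e, x⟫), x ≠ (0 : ℝ) := by
    rw [map_inner_stdGaussian he]
    have := nullSingletonClass_gaussianReal (μ := 0) (v := 1) one_ne_zero
    exact Measure.ae_ne _ 0
  filter_upwards [ae_of_ae_map (by fun_prop) h] with x hx h0
  simp [h0] at hx

/-- The orthogonal projection of a standard Gaussian vector to a subspace is a standard Gaussian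
vector of that subspace. -/
lemma map_orthogonalProjection_stdGaussian [CompleteSpace V] (E : Submodule ℝ V) :
    (stdGaussian V).map E.orthogonalProjectionOnto = stdGaussian E := by
  have : IsProbabilityMeasure ((stdGaussian V).map E.orthogonalProjectionOnto) :=
    Measure.isProbabilityMeasure_map (by fun_prop)
  apply Measure.ext_of_charFun
  ext t
  rw [charFun_stdGaussian, charFun_apply, integral_map (by fun_prop) (by fun_prop)]
  have h := charFun_stdGaussian (t : V)
  rw [charFun_apply] at h
  simpa using h

lemma map_normalize_map_isometry (S : V ≃ₗᵢ[ℝ] V) :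
    ((stdGaussian V).map fun x => ‖x‖⁻¹ • x).map S = (stdGaussian V).map fun x => ‖x‖⁻¹ • x := by
  conv_rhs => rw [← stdGaussian_map S]
  have hm : Measurable fun x : V => ‖x‖⁻¹ • x := by fun_prop
  have hS : Measurable S := S.continuous.measurable
  rw [Measure.map_map hS hm, Measure.map_map hm hS]
  congr 1
  ext x
  simp

lemma addHaar_stdOrthonormalBasis :
    (stdOrthonormalBasis ℝ V).toBasis.addHaar = (volume : Measure V) :=
  (stdOrthonormalBasis ℝ V).addHaar_eq_volume

lemma map_toSphere_map_isometry (S : V ≃ₗᵢ[ℝ] V) :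
    ((volume : Measure V).toSphere.map Subtype.val).map S =
      (volume : Measure V).toSphere.map Subtype.val := by
  have hS : Measurable S := S.continuous.measurable
  ext s hs
  rw [Measure.map_apply hS hs, Measure.map_apply measurable_subtype_coe (hS hs),
    Measure.map_apply measurable_subtype_coe hs,
    Measure.toSphere_apply' _ (measurable_subtype_coe (hS hs)),
    Measure.toSphere_apply' _ (measurable_subtype_coe hs)]
  have key : Set.Ioo (0 : ℝ) 1 • (Subtype.val '' ((Subtype.val : Metric.sphere (0 : V) 1 → V) ⁻¹'
      (S ⁻¹' s))) = S ⁻¹' (Set.Ioo (0 : ℝ) 1 • (Subtype.val ''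
        ((Subtype.val : Metric.sphere (0 : V) 1 → V) ⁻¹' s))) := by
    ext x
    simp only [Set.mem_smul, Set.mem_image, Set.mem_preimage, Subtype.exists,
      mem_sphere_zero_iff_norm,
      exists_and_left, exists_prop, exists_eq_right_right]
    constructor
    · rintro ⟨c, hc, y, hy, rfl⟩
      exact ⟨c, hc, S y, by simpa using hy, by simp⟩
    · rintro ⟨c, hc, y, hy, h⟩
      refine ⟨c, hc, S.symm y, by simpa using hy, S.injective ?_⟩
      simp [h]
  rw [key, S.measurePreserving.measure_preimage_emb
    S.toHomeomorph.measurableEmbedding]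

/-- The uniform measure on the unit sphere is the law of a normalized standard Gaussian vector: both
are rotation invariant. -/
lemma uniformSphere_map_coe {n : ℕ} (E : Submodule ℝ (EuclideanSpace ℝ (Fin n))) [Nontrivial E] :
    IsProbabilityMeasure (uniformSphere E) ∧
    (uniformSphere E).map (Subtype.val : Metric.sphere (0 : E) 1 → E) =
      (stdGaussian E).map fun x => ‖x‖⁻¹ • x := by
  set σ : Measure (Metric.sphere (0 : E) 1) := (volume : Measure E).toSphere with hσ
  have hdef : uniformSphere E = (σ Set.univ)⁻¹ • σ := by
    simp only [uniformSphere, addHaar_stdOrthonormalBasis, hσ]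
  have h0 : σ Set.univ ≠ 0 := by
    rw [Ne, Measure.measure_univ_eq_zero]
    exact Measure.toSphere_ne_zero _
  have hprob : IsProbabilityMeasure (uniformSphere E) := by
    constructor
    rw [hdef, Measure.smul_apply, smul_eq_mul, ENNReal.inv_mul_cancel h0 (measure_ne_top _ _)]
  refine ⟨hprob, ?_⟩
  have hm : Measurable fun x : E => ‖x‖⁻¹ • x := by fun_prop
  have : IsProbabilityMeasure ((uniformSphere E).map (Subtype.val : Metric.sphere (0 : E) 1 → E)) :=
    Measure.isProbabilityMeasure_map (by fun_prop)
  have : IsProbabilityMeasure ((stdGaussian E).map fun x => ‖x‖⁻¹ • x) :=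
    Measure.isProbabilityMeasure_map hm.aemeasurable
  refine eq_of_map_isometry_eq _ _ (fun S => ?_) map_normalize_map_isometry ?_ ?_
  · rw [hdef, Measure.map_smul, Measure.map_smul]
    congr 1
    exact map_toSphere_map_isometry S
  · rw [ae_map_iff (by fun_prop) (measurableSet_eq_fun (by fun_prop) (by fun_prop))]
    exact Filter.Eventually.of_forall fun w => by simp
  · rw [ae_map_iff hm.aemeasurable (measurableSet_eq_fun (by fun_prop) (by fun_prop))]
    filter_upwards [stdGaussian_ae_ne_zero] with x hx
    simp [norm_smul, hx]

end GaussianVectors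

/-! ### The random direction in the kernel of a Gaussian matrix -/

section KernelDirection

open scoped RealInnerProductSpace

variable {V : Type*} [NormedAddCommGroup V] [InnerProductSpace ℝ V]

/-- The orthogonal complement of a family of vectors: the kernel of the matrix with these rows. -/
def rowKernel {m : ℕ} (A : Fin m → V) : Submodule ℝ V := (Submodule.span ℝ (Set.range A))ᗮ

lemma mem_rowKernel {m : ℕ} {A : Fin m → V} {x : V} : x ∈ rowKernel A ↔ ∀ i, ⟪A i, x⟫ = 0 := by
  rw [rowKernel, Submodule.mem_orthogonal]
  constructor
  · exact fun h i => h _ (Submodule.subset_span ⟨i, rfl⟩)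
  · intro h u hu
    induction hu using Submodule.span_induction with
    | mem x hx => obtain ⟨i, rfl⟩ := hx; exact h i
    | zero => simp
    | add x y _ _ hx hy => rw [inner_add_left, hx, hy, add_zero]
    | smul a x _ hx => rw [real_inner_smul_left, hx, mul_zero]

variable [FiniteDimensional ℝ V]

lemma nontrivial_rowKernel {m : ℕ} (hm : m < Module.finrank ℝ V) (A : Fin m → V) :
    Nontrivial (rowKernel A) := by
  rw [Submodule.nontrivial_iff_ne_bot]
  intro h
  rw [rowKernel, Submodule.orthogonal_eq_bot_iff] at h
  have h1 := finrank_range_le_card (R := ℝ) A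
  rw [Set.finrank, h, finrank_top, Fintype.card_fin] at h1
  omega

/-- The normalized orthogonal projection of `p.2` to the kernel of the matrix with rows `p.1`.
For a Gaussian `p.2` this is a uniformly random direction of that kernel. -/
def kernelDir {m : ℕ} (p : (Fin m → V) × V) : V :=
  ‖(rowKernel p.1).starProjection p.2‖⁻¹ • (rowKernel p.1).starProjection p.2

lemma inner_kernelDir {m : ℕ} (p : (Fin m → V) × V) (i : Fin m) : ⟪p.1 i, kernelDir p⟫ = 0 :=
  mem_rowKernel.1 (Submodule.smul_mem _ _ (Submodule.starProjection_apply_mem _ _)) i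

lemma starProjection_rowKernel_map (S : V ≃ₗᵢ[ℝ] V) {m : ℕ} (A : Fin m → V) (h : V) :
    (rowKernel fun i => S (A i)).starProjection (S h) = S ((rowKernel A).starProjection h) := by
  refine Submodule.eq_starProjection_of_mem_of_inner_eq_zero ?_ fun w hw => ?_
  · refine mem_rowKernel.2 fun i => ?_
    rw [S.inner_map_map]
    exact mem_rowKernel.1 (Submodule.starProjection_apply_mem _ _) i
  · obtain ⟨v, rfl⟩ := S.surjective w
    rw [← map_sub, S.inner_map_map]
    refine Submodule.starProjection_inner_eq_zero _ _ (mem_rowKernel.2 fun i => ?_)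
    rw [← S.inner_map_map]
    exact mem_rowKernel.1 hw i

lemma kernelDir_map (S : V ≃ₗᵢ[ℝ] V) {m : ℕ} (A : Fin m → V) (h : V) :
    kernelDir (fun i => S (A i), S h) = S (kernelDir (A, h)) := by
  simp [kernelDir, starProjection_rowKernel_map]

/-- The projection to the kernel is the last step of the Gram-Schmidt process, which makes its
measurability in the matrix evident. -/
lemma starProjection_rowKernel_eq_gramSchmidt {m : ℕ} (A : Fin m → V) (h : V) :
    (rowKernel A).starProjection h =
      InnerProductSpace.gramSchmidt ℝ (Fin.snoc A h : Fin (m + 1) → V) (Fin.last m) := by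
  set f : Fin (m + 1) → V := Fin.snoc A h
  set g := InnerProductSpace.gramSchmidt ℝ f
  have himg : f '' Set.Iio (Fin.last m) = Set.range A := by
    ext x
    constructor
    · rintro ⟨i, hi, rfl⟩
      obtain ⟨j, rfl⟩ := Fin.exists_castSucc_eq.2 (ne_of_lt hi)
      exact ⟨j, by simp [f]⟩
    · rintro ⟨j, rfl⟩
      exact ⟨j.castSucc, Fin.castSucc_lt_last j, by simp [f]⟩
  have hspan : Submodule.span ℝ (g '' Set.Iio (Fin.last m)) = Submodule.span ℝ (Set.range A) := by
    rw [← himg]; exact InnerProductSpace.span_gramSchmidt_Iio ℝ f (Fin.last m)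
  have hdec := InnerProductSpace.gramSchmidt_def'' ℝ f (Fin.last m)
  have hlast : f (Fin.last m) = h := by simp [f]
  rw [hlast] at hdec
  refine Submodule.eq_starProjection_of_mem_of_inner_eq_zero ?_ fun w hw => ?_
  · rw [rowKernel, ← hspan, Submodule.mem_orthogonal]
    intro u hu
    induction hu using Submodule.span_induction with
    | mem x hx =>
      obtain ⟨i, hi, rfl⟩ := hx
      exact InnerProductSpace.gramSchmidt_orthogonal ℝ f (ne_of_lt hi)
    | zero => simp
    | add x y _ _ hx hy => rw [inner_add_left, hx, hy, add_zero]
    | smul a x _ hx => rw [real_inner_smul_left, hx, mul_zero]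
  · have hmem : h - g (Fin.last m) ∈ Submodule.span ℝ (Set.range A) := by
      rw [sub_eq_of_eq_add' hdec, ← hspan]
      exact Submodule.sum_mem _ fun i hi => Submodule.smul_mem _ _
        (Submodule.subset_span ⟨i, Finset.mem_Iio.1 hi, rfl⟩)
    exact Submodule.inner_right_of_mem_orthogonal hmem hw

variable [MeasurableSpace V] [BorelSpace V]

lemma measurable_gramSchmidt {k : ℕ} (i : Fin k) :
    Measurable fun f : Fin k → V => InnerProductSpace.gramSchmidt ℝ f i := by
  induction i using WellFoundedLT.induction with
  | ind i ih =>
    have : (fun f : Fin k → V => InnerProductSpace.gramSchmidt ℝ f i) = fun f =>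
        f i - ∑ j ∈ Finset.Iio i, (⟪InnerProductSpace.gramSchmidt ℝ f j, f i⟫ /
          ‖InnerProductSpace.gramSchmidt ℝ f j‖ ^ 2) • InnerProductSpace.gramSchmidt ℝ f j := by
      ext f
      exact eq_sub_of_add_eq (InnerProductSpace.gramSchmidt_def'' ℝ f i).symm
    rw [this]
    refine (measurable_pi_apply i).sub (Finset.measurable_sum _ fun j hj => ?_)
    have hj := ih j (Finset.mem_Iio.1 hj)
    fun_prop

lemma measurable_kernelDir {m : ℕ} : Measurable (kernelDir : (Fin m → V) × V → V) := by
  have hs : Measurable fun p : (Fin m → V) × V => (Fin.snoc p.1 p.2 : Fin (m + 1) → V) := by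
    refine measurable_pi_iff.2 fun i => ?_
    refine Fin.lastCases ?_ (fun j => ?_) i
    · simpa using measurable_snd
    · simp only [Fin.snoc_castSucc]
      fun_prop
  have h : Measurable fun p : (Fin m → V) × V => (rowKernel p.1).starProjection p.2 := by
    simp only [starProjection_rowKernel_eq_gramSchmidt]
    exact (measurable_gramSchmidt (Fin.last m)).comp hs
  unfold kernelDir
  fun_prop

end KernelDirection

/-! ### Decoupling a Gaussian matrix from a direction of its kernel -/

section Decoupling

open scoped RealInnerProductSpace

variable {V : Type*} [NormedAddCommGroup V] [InnerProductSpace ℝ V] [FiniteDimensional ℝ V]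
  [MeasurableSpace V] [BorelSpace V]

/-- The law of `m` independent standard Gaussian rows together with one more independent standard
Gaussian vector. -/
def gaussianFrame (m : ℕ) (V : Type*) [NormedAddCommGroup V] [InnerProductSpace ℝ V]
    [FiniteDimensional ℝ V] [MeasurableSpace V] : Measure ((Fin m → V) × V) :=
  (Measure.pi fun _ => stdGaussian V).prod (stdGaussian V)

instance isProbabilityMeasure_gaussianFrame {m : ℕ} :
    IsProbabilityMeasure (gaussianFrame m V) := by
  unfold gaussianFrame; infer_instance

lemma measurePreserving_stdGaussian (S : V ≃ₗᵢ[ℝ] V) :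
    MeasurePreserving S (stdGaussian V) (stdGaussian V) :=
  ⟨S.continuous.measurable, stdGaussian_map S⟩

lemma measurePreserving_gaussianFrame (m : ℕ) (S : V ≃ₗᵢ[ℝ] V) :
    MeasurePreserving (fun p : (Fin m → V) × V => ((fun i => S (p.1 i), S p.2) : (Fin m → V) × V))
      (gaussianFrame m V) (gaussianFrame m V) :=
  (measurePreserving_pi _ _ fun _ => measurePreserving_stdGaussian S).prod
    (measurePreserving_stdGaussian S)

lemma norm_kernelDir_ae {m : ℕ} (hm : m < Module.finrank ℝ V) :
    ∀ᵐ p ∂(gaussianFrame m V), ‖kernelDir p‖ = 1 := by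
  have := FiniteDimensional.complete ℝ V
  have hmeas : MeasurableSet {p : (Fin m → V) × V | ‖kernelDir p‖ = 1} :=
    measurableSet_eq_fun measurable_kernelDir.norm measurable_const
  rw [gaussianFrame, Measure.ae_prod_iff_ae_ae hmeas]
  refine Filter.Eventually.of_forall fun A => ?_
  have := nontrivial_rowKernel hm A
  have h := stdGaussian_ae_ne_zero (V := rowKernel A)
  rw [← map_orthogonalProjection_stdGaussian] at h
  filter_upwards [ae_of_ae_map (by fun_prop) h] with x hx
  have hx' : (rowKernel A).starProjection x ≠ 0 := by
    exact fun h => hx (Subtype.ext h)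
  simp [kernelDir, norm_smul, hx']

lemma lintegral_kernelDir_map {m : ℕ} {f : (Fin m → V) × V → ENNReal} (hf : Measurable f)
    (S : V ≃ₗᵢ[ℝ] V) :
    ∫⁻ p, f (fun i => S (p.1 i), S (kernelDir p)) ∂(gaussianFrame m V) =
      ∫⁻ p, f (p.1, kernelDir p) ∂(gaussianFrame m V) := by
  have hmf : Measurable fun p : (Fin m → V) × V => f (p.1, kernelDir p) :=
    hf.comp (measurable_fst.prodMk measurable_kernelDir)
  refine Eq.trans (lintegral_congr fun p => ?_)
    ((measurePreserving_gaussianFrame m S).lintegral_comp hmf)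
  exact congrArg (fun v => f (fun i => S (p.1 i), v)) (kernelDir_map S p.1 p.2).symm

/-- The joint law of a Gaussian matrix and a uniform direction of its kernel can be sampled in
two independent steps: a rotation chooses the direction, and the matrix is moved accordingly. -/
lemma lintegral_kernelDir_eq [CompleteSpace V] {m : ℕ} (hm : m < Module.finrank ℝ V) {e : V}
    (he : ‖e‖ = 1) {f : (Fin m → V) × V → ENNReal} (hf : Measurable f) :
    ∫⁻ p, f (p.1, kernelDir p) ∂(gaussianFrame m V) =
      ∫⁻ O, ∫⁻ p, f (fun i => rotInv O (exchange (kernelDir p) e (p.1 i)), rotInv O e)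
        ∂(gaussianFrame m V) ∂(rotationHaar V) := by
  have hmf : Measurable fun p : (Fin m → V) × V => f (p.1, kernelDir p) :=
    hf.comp (measurable_fst.prodMk measurable_kernelDir)
  have hrow : ∀ i : Fin m, Measurable fun q : Rotation V × ((Fin m → V) × V) => q.2.1 i := by
    intro i; fun_prop
  have hdir : Measurable fun q : Rotation V × ((Fin m → V) × V) => kernelDir q.2 :=
    measurable_kernelDir.comp measurable_snd
  have hrot : ∀ g : Rotation V × ((Fin m → V) × V) → V, Measurable g →
      Measurable fun q : Rotation V × ((Fin m → V) × V) => rotInv q.1 (g q) := fun g hg =>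
    measurable_rotInv_comp measurable_fst hg
  have h2 : Measurable fun q : Rotation V × ((Fin m → V) × V) =>
      f (fun i => rotInv q.1 (q.2.1 i), rotInv q.1 (kernelDir q.2)) :=
    hf.comp ((measurable_pi_iff.2 fun i => hrot _ (hrow i)).prodMk (hrot _ hdir))
  have h3 : Measurable fun q : Rotation V × ((Fin m → V) × V) =>
      f (fun i => rotInv q.1 (exchange (kernelDir q.2) e (q.2.1 i)), rotInv q.1 e) :=
    hf.comp ((measurable_pi_iff.2 fun i => hrot _
      (measurable_exchange_comp hdir measurable_const (hrow i))).prodMk (hrot _ measurable_const))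
  have h4 : ∀ p : (Fin m → V) × V, ‖kernelDir p‖ = 1 →
      ∫⁻ O, f (fun i => rotInv O (p.1 i), rotInv O (kernelDir p)) ∂(rotationHaar V) =
      ∫⁻ O, f (fun i => rotInv O (exchange (kernelDir p) e (p.1 i)), rotInv O e)
        ∂(rotationHaar V) := fun p hp => by
    rw [← lintegral_rotationHaar_rotInv_trans (exchange (kernelDir p) e) fun T =>
      f (fun i => T (p.1 i), T (kernelDir p))]
    simp only [LinearIsometryEquiv.trans_apply, exchange_left (hp.trans he.symm)]
  have h5 : ∫⁻ p, f (p.1, kernelDir p) ∂(gaussianFrame m V) =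
      ∫⁻ O, ∫⁻ p, f (fun i => rotInv O (p.1 i), rotInv O (kernelDir p))
        ∂(gaussianFrame m V) ∂(rotationHaar V) := by
    simp only [lintegral_kernelDir_map hf, lintegral_const, measure_univ, mul_one]
  rw [h5, lintegral_lintegral_swap h2.aemeasurable]
  exact (lintegral_congr_ae ((norm_kernelDir_ae hm).mono fun p hp => h4 p hp)).trans
    (lintegral_lintegral_swap h3.aemeasurable).symm

end Decoupling

/-! ### The image of a fixed vector under the decoupled matrix -/

section FixedVector

open scoped RealInnerProductSpace

/-- A reflection which fixes `e` and moves the part of `w` orthogonal to `e` to a multiple of the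
corresponding part of `g`. -/
lemma exists_isometry_fixing {V : Type*} [NormedAddCommGroup V] [InnerProductSpace ℝ V] {e : V}
    (he : ‖e‖ = 1) (w : V) {g : V} (hg : 0 < ‖g‖ ^ 2 - ⟪e, g⟫ ^ 2) :
    ∃ (x y : V) (c : ℝ), exchange x y e = e ∧
      c ^ 2 * (‖g‖ ^ 2 - ⟪e, g⟫ ^ 2) ≤ ‖w‖ ^ 2 ∧
      ∀ a : V, ⟪a, e⟫ = 0 → ⟪a, exchange x y w⟫ = c * ⟪a, g⟫ := by
  have hperp : ∀ v : V, ⟪v - ⟪e, v⟫ • e, e⟫ = 0 := fun v => by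
    rw [inner_sub_left, real_inner_smul_left, real_inner_self_eq_norm_sq, he, real_inner_comm]
    ring
  have hnorm : ∀ v : V, ‖v - ⟪e, v⟫ • e‖ ^ 2 = ‖v‖ ^ 2 - ⟪e, v⟫ ^ 2 := fun v => by
    rw [norm_sub_sq_real, norm_smul, he, real_inner_smul_right, real_inner_comm, mul_one,
      Real.norm_eq_abs, sq_abs]
    ring
  set w' := w - ⟪e, w⟫ • e with hw'
  set g' := g - ⟪e, g⟫ • e with hg'
  have hg0 : 0 < ‖g'‖ := by
    have : 0 < ‖g'‖ ^ 2 := by rw [hnorm]; exact hg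
    exact lt_of_le_of_ne (norm_nonneg _) fun h0 => by rw [← h0] at this; simp at this
  set c : ℝ := ‖w'‖ / ‖g'‖
  have hxy : ‖w'‖ = ‖c • g'‖ := by
    rw [norm_smul, Real.norm_of_nonneg (by positivity), div_mul_cancel₀ _ hg0.ne']
  have hSe : exchange w' (c • g') e = e := by
    rw [exchange_apply, inner_sub_left, real_inner_smul_left, hperp, hperp]
    simp
  refine ⟨w', c • g', c, hSe, ?_, fun a ha => ?_⟩
  · rw [← hnorm g, ← hg', div_pow, div_mul_cancel₀ _ (by positivity), hw', hnorm]
    nlinarith [sq_nonneg ⟪e, w⟫]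
  · have : w = w' + ⟪e, w⟫ • e := by simp [w']
    rw [this, map_add, map_smul, hSe, exchange_left hxy, inner_add_right, real_inner_smul_right,
      real_inner_smul_right, ha, hg', inner_sub_right, real_inner_smul_right, ha]
    ring

variable {V : Type*} [NormedAddCommGroup V] [InnerProductSpace ℝ V] [FiniteDimensional ℝ V]
  [MeasurableSpace V] [BorelSpace V]

/-- The matrix `A`, moved so that its chosen kernel direction becomes the fixed vector `e`, is
unlikely to stretch a fixed vector `w`: rotations fixing `e` leave the law of the moved matrix
invariant, so that `w` may be replaced by an independent Gaussian vector. -/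
lemma gaussianFrame_exchange_le {m : ℕ} (hm : m < Module.finrank ℝ V) {e : V} (he : ‖e‖ = 1)
    {τ κ : ℝ} (hτ : 0 ≤ τ) {q : ENNReal}
    (hq : ∀ v : V, (Measure.pi fun _ : Fin m => stdGaussian V)
      {A | τ * ‖v‖ ^ 2 < ∑ i, ⟪A i, v⟫ ^ 2} ≤ q) (w : V) :
    gaussianFrame m V
        {p | τ * κ * ‖w‖ ^ 2 < ∑ i, ⟪exchange (kernelDir p) e (p.1 i), w⟫ ^ 2} ≤
      q + stdGaussian V {g | κ * (‖g‖ ^ 2 - ⟪e, g⟫ ^ 2) ≤ ‖g‖ ^ 2} := by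
  have hrow : ∀ i : Fin m, Measurable fun p : (Fin m → V) × V =>
      exchange (kernelDir p) e (p.1 i) := fun i =>
    measurable_exchange_comp measurable_kernelDir measurable_const (by fun_prop)
  set N : Set V := {g | κ * (‖g‖ ^ 2 - ⟪e, g⟫ ^ 2) ≤ ‖g‖ ^ 2} with hN
  have hNm : MeasurableSet N := measurableSet_le (by fun_prop) (by fun_prop)
  set T : Set (V × ((Fin m → V) × V)) :=
    {x | τ * ‖x.1‖ ^ 2 < ∑ i, ⟪exchange (kernelDir x.2) e (x.2.1 i), x.1⟫ ^ 2} with hT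
  have hTm : MeasurableSet T := by
    have h : ∀ i, Measurable fun x : V × ((Fin m → V) × V) =>
        exchange (kernelDir x.2) e (x.2.1 i) := fun i => (hrow i).comp measurable_snd
    exact measurableSet_lt (by fun_prop)
      (Finset.measurable_sum _ fun i _ => ((h i).inner measurable_fst).pow_const 2)
  set T' : Set (V × ((Fin m → V) × V)) :=
    {x | τ * ‖x.1‖ ^ 2 < ∑ i, ⟪x.2.1 i, x.1⟫ ^ 2} with hT'
  have hTm' : MeasurableSet T' := measurableSet_lt (by fun_prop) (by fun_prop)
  have hEm : MeasurableSet {p : (Fin m → V) × V |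
      τ * κ * ‖w‖ ^ 2 < ∑ i, ⟪exchange (kernelDir p) e (p.1 i), w⟫ ^ 2} :=
    measurableSet_lt measurable_const
      (Finset.measurable_sum _ fun i _ => ((hrow i).inner measurable_const).pow_const 2)
  set E := {p : (Fin m → V) × V |
      τ * κ * ‖w‖ ^ 2 < ∑ i, ⟪exchange (kernelDir p) e (p.1 i), w⟫ ^ 2} with hE
  -- Outside of `N`, the vector `w` may be replaced by `g`.
  have hstep : ∀ g, g ∉ N → gaussianFrame m V E ≤ gaussianFrame m V (Prod.mk g ⁻¹' T) := by
    intro g hg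
    simp only [hN, Set.mem_ofPred_eq, not_le] at hg
    have hcs : ⟪e, g⟫ ^ 2 ≤ ‖g‖ ^ 2 := by
      have := abs_real_inner_le_norm e g
      rw [he, one_mul] at this
      exact sq_le_sq' (by linarith [neg_abs_le ⟪e, g⟫]) ((le_abs_self _).trans this)
    have hpos : 0 < ‖g‖ ^ 2 - ⟪e, g⟫ ^ 2 := by
      rcases hcs.lt_or_eq with h | h
      · linarith
      · rw [h, sub_self, mul_zero] at hg
        exact absurd hg (not_lt.2 (sq_nonneg _))
    obtain ⟨x, y, c, hSe, hc, hS⟩ := exists_isometry_fixing he w hpos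
    rw [← (measurePreserving_gaussianFrame m (exchange x y)).measure_preimage
      hEm.nullMeasurableSet]
    refine measure_mono_ae ((norm_kernelDir_ae hm).mono fun p hp hpE => ?_)
    have h0 : ∀ i, ⟪exchange (kernelDir p) e (p.1 i), e⟫ = 0 := fun i => by
      rw [inner_exchange, exchange_right (hp.trans he.symm), inner_kernelDir]
    have h1 : ∀ i, ⟪exchange (kernelDir (fun i => exchange x y (p.1 i), exchange x y p.2)) e
        (exchange x y (p.1 i)), w⟫ = c * ⟪exchange (kernelDir p) e (p.1 i), g⟫ := fun i => by
      have h2 := exchange_map (exchange x y) (kernelDir p) e (p.1 i)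
      rw [hSe] at h2
      rw [kernelDir_map, h2, inner_exchange, hS _ (h0 i)]
    change τ * ‖g‖ ^ 2 < ∑ i, ⟪exchange (kernelDir p) e (p.1 i), g⟫ ^ 2
    have hpE : τ * κ * ‖w‖ ^ 2 < ∑ i, ⟪exchange (kernelDir (fun i => exchange x y (p.1 i),
      exchange x y p.2)) e (exchange x y (p.1 i)), w⟫ ^ 2 := hpE
    simp only [h1, mul_pow, ← Finset.mul_sum] at hpE
    set Z := ∑ i, ⟪exchange (kernelDir p) e (p.1 i), g⟫ ^ 2
    have hκ : 0 ≤ κ := by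
      by_contra hκ
      nlinarith [sq_nonneg ‖g‖]
    by_contra hcon
    rw [not_lt] at hcon
    have h3 : c ^ 2 * Z ≤ c ^ 2 * (τ * (κ * (‖g‖ ^ 2 - ⟪e, g⟫ ^ 2))) := by
      gcongr
      exact hcon.trans (mul_le_mul_of_nonneg_left hg.le hτ)
    have h4 := mul_le_mul_of_nonneg_left hc (mul_nonneg hτ hκ)
    linarith
  have hint : ∫⁻ g, gaussianFrame m V (Prod.mk g ⁻¹' T) ∂(stdGaussian V) ≤ q := by
    rw [← Measure.prod_apply hTm, Measure.prod_apply_symm hTm]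
    have h1 : ∀ p : (Fin m → V) × V, stdGaussian V ((fun g => (g, p)) ⁻¹' T) =
        stdGaussian V ((fun g => (g, p)) ⁻¹' T') := fun p => by
      rw [← (measurePreserving_stdGaussian (exchange (kernelDir p) e)).measure_preimage
        (measurable_prodMk_right hTm').nullMeasurableSet]
      congr 1
      ext g
      simp [hT, hT', inner_exchange]
    simp only [h1]
    rw [← Measure.prod_apply_symm hTm', Measure.prod_apply hTm']
    refine (lintegral_mono fun g => ?_).trans (by simp : ∫⁻ _ : V, q ∂(stdGaussian V) ≤ q)
    have h2 : Prod.mk g ⁻¹' T' =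
        {A : Fin m → V | τ * ‖g‖ ^ 2 < ∑ i, ⟪A i, g⟫ ^ 2} ×ˢ (Set.univ : Set V) := by
      ext p
      simp [hT']
    change gaussianFrame m V (Prod.mk g ⁻¹' T') ≤ q
    rw [h2, gaussianFrame, Measure.prod_prod, measure_univ, mul_one]
    exact hq g
  calc gaussianFrame m V E = ∫⁻ _, gaussianFrame m V E ∂(stdGaussian V) := by simp
    _ ≤ ∫⁻ g, (gaussianFrame m V (Prod.mk g ⁻¹' T) + N.indicator 1 g) ∂(stdGaussian V) := by
        refine lintegral_mono fun g => ?_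
        by_cases hg : g ∈ N
        · simp only [hg, Set.indicator_of_mem, Pi.one_apply]
          exact prob_le_one.trans le_add_self
        · exact (hstep g hg).trans le_self_add
    _ = ∫⁻ g, gaussianFrame m V (Prod.mk g ⁻¹' T) ∂(stdGaussian V) + stdGaussian V N := by
        rw [lintegral_add_right _ (measurable_one.indicator hNm), lintegral_indicator_one hNm]
    _ ≤ q + stdGaussian V N := by gcongr

end FixedVector

/-! ### The joint law of the matrix and the unrounded kernel vector -/

section KernelVectorLaw

open scoped RealInnerProductSpace

variable {V : Type*} [NormedAddCommGroup V] [InnerProductSpace ℝ V] [FiniteDimensional ℝ V]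
  [MeasurableSpace V] [BorelSpace V]

/-- The joint law of a Gaussian matrix, given by its rows, and of a random vector of its kernel:
the direction of that vector is uniform, and its length is that of an independent standard
Gaussian vector. -/
def kernelVectorLaw (m : ℕ) (V : Type*) [NormedAddCommGroup V] [InnerProductSpace ℝ V]
    [FiniteDimensional ℝ V] [MeasurableSpace V] : Measure ((Fin m → V) × V) :=
  ((gaussianFrame m V).prod (stdGaussian V)).map fun x => (x.1.1, ‖x.2‖ • kernelDir x.1)

lemma measurable_scaled_kernelDir {m : ℕ} :
    Measurable fun x : ((Fin m → V) × V) × V => (x.1.1, ‖x.2‖ • kernelDir x.1) := by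
  have h : Measurable fun x : ((Fin m → V) × V) × V => kernelDir x.1 :=
    measurable_kernelDir.comp measurable_fst
  fun_prop

instance isProbabilityMeasure_kernelVectorLaw {m : ℕ} :
    IsProbabilityMeasure (kernelVectorLaw m V) :=
  Measure.isProbabilityMeasure_map measurable_scaled_kernelDir.aemeasurable

lemma kernelVectorLaw_inner_ae {m : ℕ} :
    ∀ᵐ p ∂(kernelVectorLaw m V), ∀ i, ⟪p.1 i, p.2⟫ = 0 := by
  have h : MeasurableSet {p : (Fin m → V) × V | ∀ i, ⟪p.1 i, p.2⟫ = 0} := by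
    have : {p : (Fin m → V) × V | ∀ i, ⟪p.1 i, p.2⟫ = 0} = ⋂ i, {p | ⟪p.1 i, p.2⟫ = 0} := by
      ext; simp
    rw [this]
    exact MeasurableSet.iInter fun i => measurableSet_eq_fun (by fun_prop) (by fun_prop)
  rw [kernelVectorLaw, ae_map_iff measurable_scaled_kernelDir.aemeasurable h]
  refine Filter.Eventually.of_forall fun x i => ?_
  simp [real_inner_smul_right, inner_kernelDir]

lemma lintegral_kernelVectorLaw [CompleteSpace V] {m : ℕ} (hm : m < Module.finrank ℝ V) {e : V}
    (he : ‖e‖ = 1) {f : (Fin m → V) × V → ENNReal} (hf : Measurable f) :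
    ∫⁻ p, f p ∂(kernelVectorLaw m V) = ∫⁻ x, ∫⁻ O, ∫⁻ p,
      f (fun i => rotInv O (exchange (kernelDir p) e (p.1 i)), ‖x‖ • rotInv O e)
        ∂(gaussianFrame m V) ∂(rotationHaar V) ∂(stdGaussian V) := by
  rw [kernelVectorLaw, lintegral_map hf measurable_scaled_kernelDir]
  refine (lintegral_prod_symm _ (hf.comp measurable_scaled_kernelDir).aemeasurable).trans ?_
  refine lintegral_congr fun x => ?_
  exact lintegral_kernelDir_eq hm he
    (f := fun p => f (p.1, ‖x‖ • p.2)) (hf.comp (by fun_prop))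

/-- The kernel vector itself is a standard Gaussian vector. -/
lemma kernelVectorLaw_snd {m : ℕ} (hm : m < Module.finrank ℝ V)
    {D : Set V} (hD : MeasurableSet D) :
    kernelVectorLaw m V {p | p.2 ∈ D} = stdGaussian V D := by
  have := FiniteDimensional.complete ℝ V
  have : Nontrivial V := Module.nontrivial_of_finrank_pos (R := ℝ) (by omega)
  obtain ⟨e, he⟩ := exists_norm_eq V zero_le_one
  have hDm : Measurable (D.indicator (1 : V → ENNReal)) := measurable_one.indicator hD
  have hpolar := lintegral_eq_polar (stdGaussian V)
    (fun S => (measurePreserving_stdGaussian S).map_eq) he hDm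
  have hlaw := lintegral_kernelVectorLaw (m := m) hm he
    (f := fun p => D.indicator (1 : V → ENNReal) p.2) (hDm.comp measurable_snd)
  simp only [lintegral_const, measure_univ, mul_one] at hlaw
  rw [← lintegral_indicator_one hD, hpolar, ← hlaw]
  exact (lintegral_indicator_one (measurable_snd hD)).symm

/-- Even conditionally on the kernel vector `g`, the matrix is unlikely to stretch a vector `b g`
determined by it. -/
lemma kernelVectorLaw_stretch_le {m : ℕ} (hm : m < Module.finrank ℝ V) {e : V} (he : ‖e‖ = 1)
    {t : ℝ} {q : ENNReal}
    (hq : ∀ w, gaussianFrame m V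
      {p | t * ‖w‖ ^ 2 < ∑ i, ⟪exchange (kernelDir p) e (p.1 i), w⟫ ^ 2} ≤ q)
    {b : V → V} (hb : Measurable b) {D : Set V} (hD : MeasurableSet D) :
    kernelVectorLaw m V {p | p.2 ∈ D ∧ t * ‖b p.2‖ ^ 2 < ∑ i, ⟪p.1 i, b p.2⟫ ^ 2} ≤
      q * stdGaussian V D := by
  have := FiniteDimensional.complete ℝ V
  set T : Set ((Fin m → V) × V) :=
    {p | p.2 ∈ D ∧ t * ‖b p.2‖ ^ 2 < ∑ i, ⟪p.1 i, b p.2⟫ ^ 2} with hT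
  have hTm : MeasurableSet T := by
    have h : Measurable fun p : (Fin m → V) × V => b p.2 := hb.comp measurable_snd
    have h' : ∀ i, Measurable fun p : (Fin m → V) × V => p.1 i := fun i => by fun_prop
    exact (measurable_snd hD).inter (measurableSet_lt ((h.norm.pow_const 2).const_mul t)
      (Finset.measurable_sum _ fun i _ => ((h' i).inner h).pow_const 2))
  have hDm : Measurable (D.indicator (1 : V → ENNReal)) := measurable_one.indicator hD
  have hpolar := lintegral_eq_polar (stdGaussian V)
    (fun S => (measurePreserving_stdGaussian S).map_eq) he hDm
  have hmeas : Measurable fun z : V × Rotation V => ‖z.1‖ • rotInv z.2 e := by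
    have := measurable_rotInv_comp (V := V) (measurable_snd : Measurable
      (Prod.snd : V × Rotation V → Rotation V)) (measurable_const (a := e))
    fun_prop
  rw [← lintegral_indicator_one hTm,
    lintegral_kernelVectorLaw hm he (measurable_one.indicator hTm)]
  calc _ ≤ ∫⁻ x, ∫⁻ O, q * D.indicator 1 (‖x‖ • rotInv O e) ∂(rotationHaar V)
        ∂(stdGaussian V) := by
        refine lintegral_mono fun x => lintegral_mono fun O => ?_
        set g := ‖x‖ • rotInv O e
        by_cases hg : g ∈ D
        · rw [Set.indicator_of_mem hg, Pi.one_apply, mul_one]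
          refine le_trans ?_ (hq ((rotInv O).symm (b g)))
          set E := {p : (Fin m → V) × V | t * ‖(rotInv O).symm (b g)‖ ^ 2 <
            ∑ i, ⟪exchange (kernelDir p) e (p.1 i), (rotInv O).symm (b g)⟫ ^ 2} with hE
          refine le_trans (lintegral_mono fun p => ?_) (lintegral_indicator_one_le E)
          refine Set.indicator_apply_le' (fun hp => ?_) fun _ => zero_le
          have hpE : p ∈ E := by
            have h2 := hp.2
            simp only [← (rotInv O).symm.inner_map_map (rotInv O _),
              LinearIsometryEquiv.symm_apply_apply] at h2
            simpa [hE] using h2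
          simp [hpE]
        · rw [Set.indicator_of_notMem hg, mul_zero]
          refine (lintegral_eq_zero_of_ae_eq_zero (Filter.Eventually.of_forall fun p => ?_)).le
          exact Set.indicator_of_notMem (fun h => hg h.1) _
    _ = q * ∫⁻ x, ∫⁻ O, D.indicator 1 (‖x‖ • rotInv O e) ∂(rotationHaar V)
        ∂(stdGaussian V) := by
        have h : ∀ x : V, ∫⁻ O, q * D.indicator 1 (‖x‖ • rotInv O e) ∂(rotationHaar V) =
            q * ∫⁻ O, D.indicator 1 (‖x‖ • rotInv O e) ∂(rotationHaar V) := fun x =>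
          lintegral_const_mul _ (hDm.comp (hmeas.comp measurable_prodMk_left))
        simp only [h]
        exact lintegral_const_mul _ (hDm.comp hmeas).lintegral_prod_right'
    _ = _ := by
        rw [← hpolar, lintegral_indicator_one hD]

end KernelVectorLaw

/-! ### Tail bounds for Gaussian vectors -/

section Tails

open scoped RealInnerProductSpace

lemma integral_exp_mul_sq_gaussianReal {a : ℝ} (ha : a < 1 / 2) :
    ∫ x, Real.exp (a * x ^ 2) ∂(gaussianReal 0 1) = 1 / √(1 - 2 * a) := by
  rw [integral_gaussianReal_eq_integral_smul one_ne_zero]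
  have h : ∀ x : ℝ, gaussianPDFReal 0 1 x • Real.exp (a * x ^ 2) =
      (√(2 * Real.pi))⁻¹ * Real.exp (-(1 / 2 - a) * x ^ 2) := fun x => by
    rw [gaussianPDFReal, smul_eq_mul, mul_assoc, ← Real.exp_add]
    simp only [NNReal.coe_one, mul_one, sub_zero]
    congr 2
    ring
  simp only [h]
  rw [integral_const_mul, integral_gaussian, ← Real.sqrt_inv, ← Real.sqrt_mul (by positivity),
    one_div (√_), ← Real.sqrt_inv]
  congr 1
  have : (1 : ℝ) / 2 - a ≠ 0 := by linarith
  have : 1 - 2 * a ≠ 0 := by linarith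
  have := Real.pi_ne_zero
  field_simp

lemma integrable_exp_mul_sq_gaussianReal {a : ℝ} (ha : a < 1 / 2) :
    Integrable (fun x => Real.exp (a * x ^ 2)) (gaussianReal 0 1) := by
  by_contra h
  have h1 := integral_exp_mul_sq_gaussianReal ha
  rw [integral_undef h] at h1
  have : 0 < √(1 - 2 * a) := Real.sqrt_pos.2 (by linarith)
  exact absurd h1 (by positivity)

lemma integral_exp_three_eighths_sq :
    ∫ x, Real.exp (3 / 8 * x ^ 2) ∂(gaussianReal 0 1) = 2 := by
  rw [integral_exp_mul_sq_gaussianReal (by norm_num),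
    show (1 : ℝ) - 2 * (3 / 8) = (1 / 2) ^ 2 by norm_num, Real.sqrt_sq (by norm_num)]
  norm_num

lemma integral_exp_neg_sq :
    ∫ x, Real.exp (-(4095 / 2) * x ^ 2) ∂(gaussianReal 0 1) = 1 / 64 := by
  rw [integral_exp_mul_sq_gaussianReal (by norm_num),
    show (1 : ℝ) - 2 * (-(4095 / 2)) = 64 ^ 2 by norm_num, Real.sqrt_sq (by norm_num)]

/-- The exponential Markov inequality for a sum of independent terms. -/
lemma measure_pi_le_exp_mul_prod {ι : Type*} [Fintype ι] {E : Type*} [MeasurableSpace E]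
    (μ : Measure E) [IsProbabilityMeasure μ] (Φ : ι → E → ℝ)
    (hΦ : ∀ i, Integrable (fun x => Real.exp (Φ i x)) μ) {M : ι → ℝ}
    (hM : ∀ i, ∫ x, Real.exp (Φ i x) ∂μ ≤ M i) (T : ℝ) :
    (Measure.pi fun _ : ι => μ) {x | T ≤ ∑ i, Φ i (x i)} ≤
      ENNReal.ofReal (Real.exp (-T) * ∏ i, M i) := by
  have hint : Integrable (fun x : ι → E => ∏ i, Real.exp (Φ i (x i)))
      (Measure.pi fun _ : ι => μ) := Integrable.fintype_prod hΦ
  have hint' : Integrable (fun x : ι → E => Real.exp (∑ i, Φ i (x i)))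
      (Measure.pi fun _ : ι => μ) := by simpa only [Real.exp_sum] using hint
  have hmark := mul_meas_ge_le_integral_of_nonneg
    (Filter.Eventually.of_forall fun x : ι → E => (Real.exp_pos (∑ i, Φ i (x i))).le)
    hint' (Real.exp T)
  have heq : ∫ x, Real.exp (∑ i, Φ i (x i)) ∂(Measure.pi fun _ : ι => μ) =
      ∏ i, ∫ x, Real.exp (Φ i x) ∂μ := by
    simp only [Real.exp_sum]
    exact integral_fintype_prod_eq_prod (𝕜 := ℝ) fun i x => Real.exp (Φ i x)
  simp only [Real.exp_le_exp] at hmark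
  rw [heq] at hmark
  have hprod : ∏ i, ∫ x, Real.exp (Φ i x) ∂μ ≤ ∏ i, M i :=
    Finset.prod_le_prod (fun i _ => integral_nonneg fun x => (Real.exp_pos _).le) fun i _ => hM i
  rw [← ofReal_measureReal]
  refine ENNReal.ofReal_le_ofReal ?_
  rw [Real.exp_neg, inv_mul_eq_div, le_div_iff₀ (Real.exp_pos T), mul_comm]
  exact hmark.trans hprod

variable {n : ℕ}

lemma stdGaussian_euclidean_apply (S : Set (EuclideanSpace ℝ (Fin n))) :
    stdGaussian (EuclideanSpace ℝ (Fin n)) S =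
      (Measure.pi fun _ : Fin n => gaussianReal 0 1) (WithLp.toLp 2 ⁻¹' S) := by
  rw [← map_pi_eq_stdGaussian]
  exact (MeasurableEquiv.toLp 2 (Fin n → ℝ)).map_apply S

lemma gaussian_rows_stretch_le {V : Type*} [NormedAddCommGroup V] [InnerProductSpace ℝ V]
    [FiniteDimensional ℝ V] [MeasurableSpace V] [BorelSpace V] (m : ℕ) (v : V) :
    (Measure.pi fun _ : Fin m => stdGaussian V)
      {A | 16 * m * ‖v‖ ^ 2 < ∑ i, ⟪A i, v⟫ ^ 2} ≤ ENNReal.ofReal ((1 / 16) ^ m) := by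
  rcases eq_or_ne v 0 with rfl | hv
  · simp
  have hv' : 0 < ‖v‖ := norm_pos_iff.2 hv
  set e := ‖v‖⁻¹ • v with he
  have he1 : ‖e‖ = 1 := by simp [he, norm_smul, hv]
  have hve : ∀ a : V, ⟪a, v⟫ = ‖v‖ * ⟪e, a⟫ := fun a => by
    rw [he, real_inner_smul_left, real_inner_comm, mul_inv_cancel_left₀ hv'.ne']
  have hmap := map_inner_stdGaussian he1
  have hI : Integrable (fun x : V => Real.exp (3 / 8 * ⟪e, x⟫ ^ 2)) (stdGaussian V) := by
    have h := integrable_exp_mul_sq_gaussianReal (a := 3 / 8) (by norm_num)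
    rw [← hmap] at h
    exact h.comp_measurable (by fun_prop)
  have hE : ∫ x : V, Real.exp (3 / 8 * ⟪e, x⟫ ^ 2) ∂(stdGaussian V) ≤ 2 := by
    have h := integral_exp_three_eighths_sq
    rw [← hmap, integral_map (by fun_prop) (by fun_prop)] at h
    exact h.le
  refine le_trans (measure_mono ?_) ((measure_pi_le_exp_mul_prod (stdGaussian V)
    (fun _ : Fin m => fun x => 3 / 8 * ⟪e, x⟫ ^ 2) (fun _ => hI) (fun _ => hE) (6 * m)).trans
    (ENNReal.ofReal_le_ofReal ?_))
  · intro A hA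
    simp only [Set.mem_ofPred_eq, hve, mul_pow, ← Finset.mul_sum] at hA ⊢
    have : 16 * m < ∑ i, ⟪e, A i⟫ ^ 2 := by
      by_contra hcon
      rw [not_lt] at hcon
      nlinarith [sq_nonneg ‖v‖]
    linarith
  · rw [Finset.prod_const, Finset.card_univ, Fintype.card_fin,
      show -(6 * (m : ℝ)) = m * (-6) by ring, Real.exp_nat_mul, ← mul_pow]
    refine pow_le_pow_left₀ (by positivity) ?_ m
    have h1 : (2 : ℝ) ≤ Real.exp 1 := by linarith [Real.add_one_le_exp (1 : ℝ)]
    have h2 : (2 : ℝ) ^ 6 ≤ Real.exp 6 := by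
      rw [show (6 : ℝ) = (6 : ℕ) * 1 by norm_num, Real.exp_nat_mul]
      exact pow_le_pow_left₀ (by norm_num) h1 6
    rw [Real.exp_neg, ← one_div, div_mul_eq_mul_div, div_le_div_iff₀ (by positivity) (by norm_num)]
    linarith

/-- A Gaussian vector is unlikely to be almost parallel to a basis vector. The constants fit the two
exponential moments above: `3 / 8 * 5460 = 4095 / 2`. -/
lemma gaussian_coordinate_dominates_le (i₀ : Fin n) :
    stdGaussian (EuclideanSpace ℝ (Fin n))
      {g | 5461 * (‖g‖ ^ 2 - ⟪EuclideanSpace.single i₀ (1 : ℝ), g⟫ ^ 2) ≤ ‖g‖ ^ 2} ≤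
      ENNReal.ofReal (2 * (1 / 64) ^ (n - 1)) := by
  classical
  rw [stdGaussian_euclidean_apply]
  set a : Fin n → ℝ := fun i => if i = i₀ then 3 / 8 else -(4095 / 2) with ha
  have ha' : ∀ i, a i < 1 / 2 := fun i => by
    simp only [ha]; split_ifs <;> norm_num
  refine le_trans (measure_mono ?_) ((measure_pi_le_exp_mul_prod (gaussianReal 0 1)
    (fun (i : Fin n) x => a i * x ^ 2) (fun i => integrable_exp_mul_sq_gaussianReal (ha' i))
    (M := fun i => if i = i₀ then 2 else 1 / 64) (fun i => ?_) 0).trans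
    (ENNReal.ofReal_le_ofReal ?_))
  · intro x hx
    simp only [Set.mem_preimage, Set.mem_ofPred_eq, EuclideanSpace.real_norm_sq_eq,
      EuclideanSpace.inner_single_left, map_one, one_mul] at hx ⊢
    rw [← Finset.add_sum_erase _ _ (Finset.mem_univ i₀)] at hx ⊢
    have h1 : ∑ i ∈ Finset.univ.erase i₀, a i * x i ^ 2 =
        -(4095 / 2) * ∑ i ∈ Finset.univ.erase i₀, x i ^ 2 := by
      rw [Finset.mul_sum]
      refine Finset.sum_congr rfl fun i hi => ?_
      rw [ha]; simp [Finset.ne_of_mem_erase hi]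
    rw [h1]
    simp only [ha, if_true]
    linarith
  · by_cases hi : i = i₀
    · simp only [ha, hi, if_true]; exact integral_exp_three_eighths_sq.le
    · simp only [ha, hi, if_false]; exact integral_exp_neg_sq.le
  · rw [← Finset.mul_prod_erase _ _ (Finset.mem_univ i₀),
      Finset.prod_congr rfl fun i hi => if_neg (Finset.ne_of_mem_erase hi)]
    simp

/-- The exponential moment at `-4095 / 2` gives `exp (4095 / 5000) / 64 < 1 / 16` per coordinate. -/
lemma gaussian_norm_small_le :
    stdGaussian (EuclideanSpace ℝ (Fin n)) {g | ‖g‖ ^ 2 ≤ n / 2500} ≤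
      ENNReal.ofReal ((1 / 16) ^ n) := by
  rw [stdGaussian_euclidean_apply]
  refine le_trans (measure_mono ?_) ((measure_pi_le_exp_mul_prod (gaussianReal 0 1)
    (fun (_ : Fin n) x => -(4095 / 2) * x ^ 2)
    (fun _ => integrable_exp_mul_sq_gaussianReal (by norm_num))
    (M := fun _ => 1 / 64) (fun _ => integral_exp_neg_sq.le) (-n)).trans
    (ENNReal.ofReal_le_ofReal ?_))
  · intro x hx
    simp only [Set.mem_preimage, Set.mem_ofPred_eq, EuclideanSpace.real_norm_sq_eq,
      ← Finset.mul_sum] at hx ⊢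
    have : (0 : ℝ) ≤ n := Nat.cast_nonneg n
    linarith
  · rw [Finset.prod_const, Finset.card_univ, Fintype.card_fin, neg_neg,
      show (n : ℝ) = n * 1 by ring, Real.exp_nat_mul, ← mul_pow]
    refine pow_le_pow_left₀ (by positivity) ?_ n
    linarith [Real.exp_one_lt_d9]

lemma gaussian_exists_large_le (s : ℝ) :
    stdGaussian (EuclideanSpace ℝ (Fin n)) {g | ∃ i, s < g i ^ 2} ≤
      ENNReal.ofReal (n * (2 * Real.exp (-(3 / 8 * s)))) := by
  have h1 : ∀ i : Fin n, stdGaussian (EuclideanSpace ℝ (Fin n)) {g | s < g i ^ 2} ≤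
      ENNReal.ofReal (2 * Real.exp (-(3 / 8 * s))) := fun i => by
    classical
    rw [stdGaussian_euclidean_apply]
    set a : Fin n → ℝ := fun j => if j = i then 3 / 8 else 0 with ha
    have ha' : ∀ j, a j < 1 / 2 := fun j => by
      simp only [ha]; split_ifs <;> norm_num
    refine le_trans (measure_mono ?_) ((measure_pi_le_exp_mul_prod (gaussianReal 0 1)
      (fun (j : Fin n) x => a j * x ^ 2) (fun j => integrable_exp_mul_sq_gaussianReal (ha' j))
      (M := fun j => if j = i then 2 else 1) (fun j => ?_) (3 / 8 * s)).trans
      (ENNReal.ofReal_le_ofReal ?_))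
    · intro x hx
      simp only [Set.mem_preimage, Set.mem_ofPred_eq] at hx ⊢
      simp only [ha, ite_mul, zero_mul, Finset.sum_ite_eq', Finset.mem_univ, if_true]
      linarith
    · by_cases hj : j = i
      · simp only [ha, hj, if_true]; exact integral_exp_three_eighths_sq.le
      · simp [ha, hj]
    · simp [mul_comm]
  have h2 : {g : EuclideanSpace ℝ (Fin n) | ∃ i, s < g i ^ 2} = ⋃ i, {g | s < g i ^ 2} := by
    ext; simp
  rw [h2]
  refine (measure_iUnion_fintype_le _ _).trans ((Finset.sum_le_sum fun i _ => h1 i).trans ?_)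
  rw [Finset.sum_const, Finset.card_univ, Fintype.card_fin, nsmul_eq_mul,
    ENNReal.ofReal_mul (Nat.cast_nonneg n), ENNReal.ofReal_natCast]

/-- A tail bound for the sum of the squares above the threshold `s`, by the exponential moment
`E exp (x² / 8 · 1_{x² > s}) ≤ 1 + 2 exp (- s / 4)`. -/
lemma gaussian_truncated_sum_le {s T : ℝ} :
    stdGaussian (EuclideanSpace ℝ (Fin n)) {g | T ≤ ∑ i, if s < g i ^ 2 then g i ^ 2 else 0} ≤
      ENNReal.ofReal (Real.exp (2 * n * Real.exp (-(s / 4)) - T / 8)) := by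
  rw [stdGaussian_euclidean_apply]
  set Φ : ℝ → ℝ := fun x => if s < x ^ 2 then 1 / 8 * x ^ 2 else 0 with hΦ
  have hΦm : Measurable Φ :=
    Measurable.ite (measurableSet_lt (by fun_prop) (by fun_prop)) (by fun_prop) (by fun_prop)
  have hle : ∀ x, Real.exp (Φ x) ≤ 1 + Real.exp (-(s / 4)) * Real.exp (3 / 8 * x ^ 2) := by
    intro x
    simp only [hΦ]
    split_ifs with hx
    · rw [← Real.exp_add]
      have : Real.exp (1 / 8 * x ^ 2) ≤ Real.exp (-(s / 4) + 3 / 8 * x ^ 2) :=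
        Real.exp_le_exp.2 (by linarith)
      linarith
    · rw [Real.exp_zero]
      have : 0 ≤ Real.exp (-(s / 4)) * Real.exp (3 / 8 * x ^ 2) := by positivity
      linarith
  have hI' : Integrable (fun x => 1 + Real.exp (-(s / 4)) * Real.exp (3 / 8 * x ^ 2))
      (gaussianReal 0 1) := (integrable_const _).add
    ((integrable_exp_mul_sq_gaussianReal (a := 3 / 8) (by norm_num)).const_mul _)
  have hI : Integrable (fun x => Real.exp (Φ x)) (gaussianReal 0 1) :=
    hI'.mono' (by fun_prop) (Filter.Eventually.of_forall fun x => by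
      rw [Real.norm_of_nonneg (Real.exp_pos _).le]; exact hle x)
  have hE : ∫ x, Real.exp (Φ x) ∂(gaussianReal 0 1) ≤ Real.exp (2 * Real.exp (-(s / 4))) := by
    refine (integral_mono hI hI' hle).trans ?_
    rw [integral_add (integrable_const _) ((integrable_exp_mul_sq_gaussianReal (a := 3 / 8)
      (by norm_num)).const_mul _), integral_const_mul, integral_exp_three_eighths_sq]
    simp only [integral_const, probReal_univ, smul_eq_mul, mul_one]
    linarith [Real.add_one_le_exp (2 * Real.exp (-(s / 4)))]
  refine le_trans (measure_mono ?_) ((measure_pi_le_exp_mul_prod (gaussianReal 0 1)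
    (fun (_ : Fin n) x => Φ x) (fun _ => hI) (fun _ => hE) (T / 8)).trans
    (ENNReal.ofReal_le_ofReal ?_))
  · intro x hx
    simp only [Set.mem_preimage, Set.mem_ofPred_eq] at hx ⊢
    have : ∑ i, Φ (x i) = 1 / 8 * ∑ i, if s < x i ^ 2 then x i ^ 2 else 0 := by
      rw [Finset.mul_sum]
      exact Finset.sum_congr rfl fun i _ => by simp [hΦ]
    rw [this]
    linarith
  · rw [Finset.prod_const, Finset.card_univ, Fintype.card_fin, ← Real.exp_nat_mul,
      ← Real.exp_add]
    exact Real.exp_le_exp.2 (by linarith)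

lemma gaussianReal_Icc_lt_one (s : ℝ) : (gaussianReal 0 1) (Set.Icc (-s) s) < 1 := by
  refine lt_of_le_of_ne prob_le_one fun h => ?_
  have h0 : (gaussianReal 0 1) (Set.Icc (-s) s)ᶜ = 0 :=
    (prob_compl_eq_zero_iff measurableSet_Icc).2 h
  have h1 := gaussianReal_absolutelyContinuous' 0 (v := 1) one_ne_zero h0
  have h2 : (volume : Measure ℝ) (Set.Ioi s) = 0 :=
    measure_mono_null (fun x hx => fun h => absurd h.2 (not_le.2 hx)) h1
  simp at h2

lemma gaussian_all_small (s : ℝ) :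
    stdGaussian (EuclideanSpace ℝ (Fin n)) {g | ∀ i, g i ∈ Set.Icc (-s) s} =
      (gaussianReal 0 1 (Set.Icc (-s) s)) ^ n := by
  rw [stdGaussian_euclidean_apply]
  have : WithLp.toLp 2 ⁻¹' {g : EuclideanSpace ℝ (Fin n) | ∀ i, g i ∈ Set.Icc (-s) s} =
      Set.univ.pi fun _ : Fin n => Set.Icc (-s) s := by
    ext x
    rw [Set.mem_univ_pi]
    rfl
  rw [this, Measure.pi_pi, Finset.prod_const, Finset.card_univ, Fintype.card_fin]

end Tails

/-! ### The rounded kernel vector -/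

section Rounding

open scoped RealInnerProductSpace

/-- Whatever the rule for ties, rounding is measurable: the fibres of `r` are intervals up to their
endpoints. -/
lemma IsNearestInteger.measurable {r : ℝ → ℤ} (hr : IsNearestInteger r) : Measurable r := by
  refine measurable_to_countable' fun k => ?_
  have h : r ⁻¹' {k} = Set.Ioo ((k : ℝ) - 1 / 2) (k + 1 / 2) ∪
      (r ⁻¹' {k} ∩ {(k : ℝ) - 1 / 2, (k : ℝ) + 1 / 2}) := by
    ext x
    simp only [Set.mem_preimage, Set.mem_singleton_iff, Set.mem_union, Set.mem_Ioo,
      Set.mem_inter_iff,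
      Set.mem_insert_iff]
    have hx := abs_le.1 (hr x)
    constructor
    · rintro rfl
      by_cases h1 : x = (r x : ℝ) - 1 / 2
      · exact Or.inr ⟨rfl, Or.inl h1⟩
      by_cases h2 : x = (r x : ℝ) + 1 / 2
      · exact Or.inr ⟨rfl, Or.inr h2⟩
      exact Or.inl ⟨lt_of_le_of_ne (by linarith) (Ne.symm h1), lt_of_le_of_ne (by linarith) h2⟩
    · rintro (⟨h1, h2⟩ | h)
      · have h3 : (r x : ℝ) < k + 1 := by linarith
        have h4 : (k : ℝ) < r x + 1 := by linarith
        have h3' : r x < k + 1 := by exact_mod_cast h3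
        have h4' : k < r x + 1 := by exact_mod_cast h4
        omega
      · exact h.1
  rw [h]
  exact measurableSet_Ioo.union
    (((Set.toFinite {(k : ℝ) - 1 / 2, (k : ℝ) + 1 / 2}).inter_of_right _).measurableSet)

lemma measurable_clipRound {r : ℝ → ℤ} (hr : IsNearestInteger r) (B : ℕ) :
    Measurable (clipRound r B) := by
  unfold clipRound
  exact Measurable.ite (measurableSet_le (by fun_prop) (by fun_prop)) hr.measurable
    (Measurable.ite measurableSet_Ioi measurable_const measurable_const)

lemma abs_clipRound_le {r : ℝ → ℤ} (hr : IsNearestInteger r) (B : ℕ) (t : ℝ) :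
    |clipRound r B t| ≤ (B : ℤ) := by
  unfold clipRound
  split_ifs with h1 h2
  · have h3 := abs_le.1 (hr t)
    have h4 := abs_le.1 h1
    have h5 : (r t : ℝ) < B + 1 := by linarith
    have h6 : -((B : ℝ) + 1) < r t := by linarith
    have h5' : r t < B + 1 := by exact_mod_cast h5
    have h6' : -((B : ℤ) + 1) < r t := by exact_mod_cast h6
    rw [abs_le]
    omega
  · simp
  · simp

lemma abs_le_of_clipRound_eq_zero {r : ℝ → ℤ} (hr : IsNearestInteger r) {B : ℕ} (hB : 1 ≤ B)
    {t : ℝ} (h : clipRound r B t = 0) : |t| ≤ 1 / 2 := by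
  unfold clipRound at h
  split_ifs at h with h1 h2
  · simpa [h] using hr t
  · omega
  · omega

lemma clipRound_sub_sq_le {r : ℝ → ℤ} (hr : IsNearestInteger r) {B : ℕ} (t : ℝ) :
    ((clipRound r B t : ℝ) - t) ^ 2 ≤ 1 / 4 + if (B : ℝ) ^ 2 < t ^ 2 then t ^ 2 else 0 := by
  have hB : (0 : ℝ) ≤ B := Nat.cast_nonneg B
  have hiff : (B : ℝ) ^ 2 < t ^ 2 ↔ ¬ |t| ≤ B := by
    rw [sq_lt_sq, abs_of_nonneg hB, not_le]
  simp only [hiff]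
  unfold clipRound
  split_ifs with h1 h2
  · have := hr t
    rw [← abs_neg, neg_sub, ← sq_le_sq₀ (abs_nonneg _) (by norm_num), sq_abs] at this
    linarith
  · rw [abs_of_pos h2, not_le] at h1
    push_cast
    nlinarith
  · rw [abs_of_nonpos (not_lt.1 h2), not_le] at h1
    push_cast
    nlinarith

variable {m n : ℕ}

/-- The vector `a • g`, rounded with clipping, as a vector of Euclidean space. -/
def roundedVec (r : ℝ → ℤ) (B : ℕ) (a : ℝ) (g : EuclideanSpace ℝ (Fin n)) :
    EuclideanSpace ℝ (Fin n) :=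
  WithLp.toLp 2 fun i => (clipRound r B (a * g i) : ℝ)

lemma measurable_roundedVec {r : ℝ → ℤ} (hr : IsNearestInteger r) (B : ℕ) (a : ℝ) :
    Measurable (roundedVec r B a : EuclideanSpace ℝ (Fin n) → EuclideanSpace ℝ (Fin n)) := by
  refine (MeasurableEquiv.toLp 2 (Fin n → ℝ)).measurable.comp (measurable_pi_iff.2 fun i => ?_)
  exact (measurable_from_top (f := fun k : ℤ => (k : ℝ))).comp
    ((measurable_clipRound hr B).comp (by fun_prop))

lemma norm_roundedVec_sub_sq_le {r : ℝ → ℤ} (hr : IsNearestInteger r) (B : ℕ) (a : ℝ)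
    (g : EuclideanSpace ℝ (Fin n)) :
    ‖roundedVec r B a g - a • g‖ ^ 2 ≤
      n / 4 + ∑ i, if (B : ℝ) ^ 2 < (a * g i) ^ 2 then (a * g i) ^ 2 else 0 := by
  rw [EuclideanSpace.real_norm_sq_eq]
  refine (Finset.sum_le_sum fun i _ => clipRound_sub_sq_le (B := B) hr (a * g i)).trans
    (le_of_eq ?_)
  rw [Finset.sum_add_distrib, Finset.sum_const, Finset.card_univ, Fintype.card_fin, nsmul_eq_mul]
  ring

/-- The rows of a matrix, as vectors of Euclidean space. -/
def euclideanRows (A : Fin m → Fin n → ℝ) : Fin m → EuclideanSpace ℝ (Fin n) :=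
  fun i => WithLp.toLp 2 (A i)

lemma inner_euclideanRows (A : Fin m → Fin n → ℝ) (i : Fin m) (x : EuclideanSpace ℝ (Fin n)) :
    ⟪euclideanRows A i, x⟫ = ∑ j, A i j * x j := by
  simp [euclideanRows, PiLp.inner_apply, mul_comm]

lemma measurePreserving_euclideanRows :
    MeasurePreserving (euclideanRows : (Fin m → Fin n → ℝ) → Fin m → EuclideanSpace ℝ (Fin n))
      (gaussianMatrix m n) (Measure.pi fun _ => stdGaussian (EuclideanSpace ℝ (Fin n))) :=
  measurePreserving_pi _ _ fun _ => ⟨(MeasurableEquiv.toLp 2 (Fin n → ℝ)).measurable,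
    map_pi_eq_stdGaussian⟩

lemma kerSpace_eq_rowKernel (A : Fin m → Fin n → ℝ) :
    kerSpace A = rowKernel (euclideanRows A) := by
  ext x
  simp only [kerSpace, LinearMap.mem_ker, mem_rowKernel, inner_euclideanRows]
  rw [← (WithLp.ofLp_injective 2).eq_iff, funext_iff]
  rfl

lemma chiSquared_eq_map :
    chiSquared n = (stdGaussian (EuclideanSpace ℝ (Fin n))).map fun x => ‖x‖ ^ 2 := by
  have hm : Measurable (WithLp.toLp 2 : (Fin n → ℝ) → EuclideanSpace ℝ (Fin n)) :=
    (MeasurableEquiv.toLp 2 (Fin n → ℝ)).measurable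
  rw [chiSquared, ← map_pi_eq_stdGaussian, Measure.map_map (by fun_prop) hm]
  congr 1
  ext v
  simp [EuclideanSpace.real_norm_sq_eq]

/-- A uniformly random unit vector of a subspace is the normalized projection of a standard Gaussian
vector. -/
lemma map_starProjection_uniformSphere (E : Submodule ℝ (EuclideanSpace ℝ (Fin n))) [Nontrivial E] :
    (uniformSphere E).map (fun u : Metric.sphere (0 : E) 1 => ((u : E) : EuclideanSpace ℝ (Fin n))) =
      (stdGaussian (EuclideanSpace ℝ (Fin n))).map
        fun x => ‖E.starProjection x‖⁻¹ • E.starProjection x := by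
  have h := congrArg (Measure.map (Subtype.val : E → EuclideanSpace ℝ (Fin n)))
    (uniformSphere_map_coe E).2
  rw [Measure.map_map (by fun_prop) (by fun_prop), ← map_orthogonalProjection_stdGaussian,
    Measure.map_map (by fun_prop) (by fun_prop), Measure.map_map (by fun_prop) (by fun_prop)] at h
  exact h

/-- The coins of the algorithm produce the same kernel vector as two independent Gaussian vectors,
one of which gives the length and the other the direction. -/
lemma kernelRoundCoins_map (hmn : m < n) (A : Fin m → Fin n → ℝ) :
    (kernelRoundCoins A).map (fun w => √w.1 • ((w.2 : kerSpace A) : EuclideanSpace ℝ (Fin n))) =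
      ((stdGaussian (EuclideanSpace ℝ (Fin n))).prod (stdGaussian (EuclideanSpace ℝ (Fin n)))).map
        fun x => ‖x.2‖ • kernelDir (euclideanRows A, x.1) := by
  have : Nontrivial (kerSpace A) := by
    rw [kerSpace_eq_rowKernel]
    exact nontrivial_rowKernel (by simpa using hmn) _
  have := (uniformSphere_map_coe (kerSpace A)).1
  have hdir := map_starProjection_uniformSphere (kerSpace A)
  have hnorm := chiSquared_eq_map (n := n)
  have hψ : Measurable fun x : ℝ × EuclideanSpace ℝ (Fin n) => √x.1 • x.2 := by fun_prop
  have hcoe : Measurable fun u : Metric.sphere (0 : kerSpace A) 1 =>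
      ((u : kerSpace A) : EuclideanSpace ℝ (Fin n)) := by fun_prop
  have hprob : IsProbabilityMeasure (chiSquared n) := by
    rw [hnorm]; exact Measure.isProbabilityMeasure_map (by fun_prop)
  have h1 : (kernelRoundCoins A).map
      (fun w => √w.1 • ((w.2 : kerSpace A) : EuclideanSpace ℝ (Fin n))) =
      ((chiSquared n).prod ((uniformSphere (kerSpace A)).map
        fun u : Metric.sphere (0 : kerSpace A) 1 => ((u : kerSpace A) : EuclideanSpace ℝ (Fin n)))).map
          fun x => √x.1 • x.2 := by
    conv_rhs => rw [← Measure.map_id (μ := chiSquared n)]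
    rw [Measure.map_prod_map _ _ measurable_id hcoe, Measure.map_map hψ (by fun_prop)]
    rfl
  rw [h1, hdir, hnorm, Measure.map_prod_map _ _ (by fun_prop) (by fun_prop),
    Measure.map_map hψ (by fun_prop)]
  conv_lhs => rw [← Measure.prod_swap]
  rw [Measure.map_map (by fun_prop) measurable_swap]
  congr 1
  ext1 x
  simp [kernelDir, kerSpace_eq_rowKernel, Real.sqrt_sq]

/-- The algorithm is at most as likely to fail as the joint law of the rows and the kernel vector is
to meet a measurable set which covers the failures. -/
lemma kernelRoundProb_le (hmn : m < n) {r : ℝ → ℤ} {K : ℝ} {B : ℕ}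
    {bad : (Fin m → Fin n → ℝ) → (Fin n → ℤ) → Prop}
    {T : Set ((Fin m → EuclideanSpace ℝ (Fin n)) × EuclideanSpace ℝ (Fin n))}
    (hT : MeasurableSet T)
    (h : ∀ (A : Fin m → Fin n → ℝ) (g : EuclideanSpace ℝ (Fin n)),
      bad A (fun i => clipRound r B ((B : ℝ) / √(4 * K * lnPlus B) * g i)) →
        (euclideanRows A, g) ∈ T) :
    kernelRoundProb r K B bad ≤ kernelVectorLaw m (EuclideanSpace ℝ (Fin n)) T := by
  set γ := stdGaussian (EuclideanSpace ℝ (Fin n)) with hγ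
  have hdir : Measurable fun z : (Fin m → EuclideanSpace ℝ (Fin n)) ×
      (EuclideanSpace ℝ (Fin n) × EuclideanSpace ℝ (Fin n)) =>
      (z.1, ‖z.2.2‖ • kernelDir (z.1, z.2.1)) := by
    have h1 : Measurable fun z : (Fin m → EuclideanSpace ℝ (Fin n)) ×
      (EuclideanSpace ℝ (Fin n) × EuclideanSpace ℝ (Fin n)) => kernelDir (z.1, z.2.1) :=
      measurable_kernelDir.comp (by fun_prop)
    fun_prop
  have hG : Measurable fun A' : Fin m → EuclideanSpace ℝ (Fin n) =>
      (γ.prod γ) {x | (A', ‖x.2‖ • kernelDir (A', x.1)) ∈ T} :=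
    measurable_measure_prodMk_left (hdir hT)
  have hpt : ∀ A : Fin m → Fin n → ℝ, kernelRoundCoins A {w | bad A (kernelRound r K B A w)} ≤
      (γ.prod γ) {x | (euclideanRows A, ‖x.2‖ • kernelDir (euclideanRows A, x.1)) ∈ T} := by
    intro A
    have hTA : MeasurableSet {g | (euclideanRows A, g) ∈ T} := measurable_prodMk_left hT
    have hm : Measurable fun x : EuclideanSpace ℝ (Fin n) × EuclideanSpace ℝ (Fin n) =>
        ‖x.2‖ • kernelDir (euclideanRows A, x.1) := by
      have h1 : Measurable fun x : EuclideanSpace ℝ (Fin n) × EuclideanSpace ℝ (Fin n) =>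
          kernelDir (euclideanRows A, x.1) := measurable_kernelDir.comp (by fun_prop)
      fun_prop
    have h2 := congrArg (fun μ => μ {g | (euclideanRows A, g) ∈ T}) (kernelRoundCoins_map hmn A)
    simp only at h2
    rw [Measure.map_apply (by fun_prop) hTA, Measure.map_apply hm hTA] at h2
    refine (measure_mono fun w hw => ?_).trans h2.le
    refine h A _ ?_
    have h3 : kernelRound r K B A w = fun i => clipRound r B ((B : ℝ) / √(4 * K * lnPlus B) *
        (√w.1 • ((w.2 : kerSpace A) : EuclideanSpace ℝ (Fin n))) i) := by
      ext i
      simp only [kernelRound, kernelVector, PiLp.smul_apply, smul_eq_mul]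
      congr 1
      ring
    rw [← h3]
    exact hw
  calc kernelRoundProb r K B bad
      ≤ ∫⁻ A, (γ.prod γ) {x | (euclideanRows A, ‖x.2‖ • kernelDir (euclideanRows A, x.1)) ∈ T}
          ∂(gaussianMatrix m n) := lintegral_mono hpt
    _ = ∫⁻ A', (γ.prod γ) {x | (A', ‖x.2‖ • kernelDir (A', x.1)) ∈ T}
          ∂(Measure.pi fun _ : Fin m => γ) := measurePreserving_euclideanRows.lintegral_comp hG
    _ = ((Measure.pi fun _ : Fin m => γ).prod (γ.prod γ))
          {z | (z.1, ‖z.2.2‖ • kernelDir (z.1, z.2.1)) ∈ T} :=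
        (Measure.prod_apply (hdir hT)).symm
    _ = kernelVectorLaw m (EuclideanSpace ℝ (Fin n)) T := by
        rw [kernelVectorLaw, Measure.map_apply measurable_scaled_kernelDir hT, gaussianFrame,
          ← (measurePreserving_prodAssoc _ _ _).measure_preimage_equiv]
        rfl

end Rounding

/-! ### Failure probabilities of the rounded vector -/

section Failure

open scoped RealInnerProductSpace

variable {m n : ℕ}

/-- The matrix stretches a vector determined by its kernel vector by a factor of more than
`√(16 * m * 5461)`, which is less than `296 * √m`, with probability at most `4⁻ᵐ`, even
conditionally on the kernel vector. -/
lemma kernelVectorLaw_stretch_euclidean_le (hmn : m < n)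
    {b : EuclideanSpace ℝ (Fin n) → EuclideanSpace ℝ (Fin n)} (hb : Measurable b)
    {D : Set (EuclideanSpace ℝ (Fin n))} (hD : MeasurableSet D) :
    kernelVectorLaw m (EuclideanSpace ℝ (Fin n))
      {p | p.2 ∈ D ∧ 16 * m * 5461 * ‖b p.2‖ ^ 2 < ∑ i, ⟪p.1 i, b p.2⟫ ^ 2} ≤
      ENNReal.ofReal ((1 / 4) ^ m) * stdGaussian (EuclideanSpace ℝ (Fin n)) D := by
  have hfin : m < Module.finrank ℝ (EuclideanSpace ℝ (Fin n)) := by simpa using hmn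
  rcases Nat.eq_zero_or_pos m with rfl | hm
  · rw [← kernelVectorLaw_snd hfin hD]
    simp
  have he : ‖EuclideanSpace.single (⟨0, by omega⟩ : Fin n) (1 : ℝ)‖ = 1 := by simp
  refine kernelVectorLaw_stretch_le hfin he (fun w => ?_) hb hD
  refine (gaussianFrame_exchange_le hfin he (by positivity) (gaussian_rows_stretch_le m) w).trans
    ((add_le_add le_rfl (gaussian_coordinate_dominates_le _)).trans ?_)
  rw [← ENNReal.ofReal_add (by positivity) (by positivity)]
  refine ENNReal.ofReal_le_ofReal ?_
  have h1 : ((1 : ℝ) / 64) ^ (n - 1) ≤ (1 / 64) ^ m :=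
    pow_le_pow_of_le_one (by norm_num) (by norm_num) (by omega)
  have h2 : ((1 : ℝ) / 64) ^ m = (1 / 4) ^ m * (1 / 16) ^ m := by rw [← mul_pow]; norm_num
  have h3 : ((1 : ℝ) / 16) ^ m = (1 / 4) ^ m * (1 / 4) ^ m := by rw [← mul_pow]; norm_num
  have h4 : ((1 : ℝ) / 4) ^ m ≤ 1 / 4 := pow_le_of_le_one (by norm_num) (by norm_num) hm.ne'
  have h5 : ((1 : ℝ) / 16) ^ m ≤ 1 / 16 := pow_le_of_le_one (by norm_num) (by norm_num) hm.ne'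
  have h6 : (0 : ℝ) < (1 / 4) ^ m := by positivity
  nlinarith

lemma sqrt_le_of_sq_le {S N : ℝ} (hN : 0 ≤ N) (h : S ≤ 16 * m * 5461 * N ^ 2) :
    √S ≤ 296 * √m * N := by
  rw [Real.sqrt_le_left (by positivity), mul_pow, mul_pow, Real.sq_sqrt (Nat.cast_nonneg m)]
  refine h.trans (mul_le_mul_of_nonneg_right ?_ (sq_nonneg N))
  have : (0 : ℝ) ≤ m := Nat.cast_nonneg m
  linarith

/-- For a small scaling factor, the required bound allows a stretch of order `√m`. -/
lemma sqrt_le_of_scale_lt {S N a : ℝ} (ha : 0 < a) (ha' : a < 300) (hN : 0 ≤ N)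
    (h : S ≤ 16 * m * 5461 * N ^ 2) : √S ≤ 100000 * (√m / a) * N := by
  refine (sqrt_le_of_sq_le hN h).trans (mul_le_mul_of_nonneg_right ?_ hN)
  rw [← mul_div_assoc, le_div_iff₀ ha]
  nlinarith [Real.sqrt_nonneg (m : ℝ)]

/-- For a large scaling factor, a short rounding error has a small image, and the rounded vector
is long. -/
lemma sqrt_le_of_le_scale {S a : ℝ} {z g : EuclideanSpace ℝ (Fin n)} (ha : 300 ≤ a) (hn : 0 < n)
    (hb : ‖z - a • g‖ ^ 2 ≤ 9 * n) (hg : (n : ℝ) / 2500 < ‖g‖ ^ 2)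
    (h : S ≤ 16 * m * 5461 * ‖z - a • g‖ ^ 2) :
    0 < ‖z‖ ∧ √S ≤ 100000 * (√m / a) * ‖z‖ := by
  have hn' : (0 : ℝ) < n := Nat.cast_pos.2 hn
  have hsn : 0 < √(n : ℝ) := Real.sqrt_pos.2 hn'
  have hsq : √(n : ℝ) ^ 2 = n := Real.sq_sqrt hn'.le
  have hb' : ‖z - a • g‖ ≤ 3 * √n := by
    refine le_of_sq_le_sq ?_ (by positivity)
    rw [mul_pow, hsq]; linarith
  have hg' : √n / 50 ≤ ‖g‖ := by
    refine le_of_sq_le_sq ?_ (norm_nonneg g)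
    rw [div_pow, hsq]; linarith
  have hz : a * √n / 100 ≤ ‖z‖ := by
    have h1 : ‖a • g‖ ≤ ‖z‖ + ‖z - a • g‖ := by
      have := norm_sub_le z (z - a • g)
      rwa [sub_sub_cancel] at this
    rw [norm_smul, Real.norm_of_nonneg (by linarith)] at h1
    nlinarith
  have ha0 : 0 < a := by linarith
  refine ⟨lt_of_lt_of_le (by positivity) hz, ?_⟩
  refine (sqrt_le_of_sq_le (norm_nonneg _) h).trans ?_
  calc 296 * √m * ‖z - a • g‖ ≤ 296 * √m * (3 * √n) := by gcongr
    _ ≤ 100000 * (√m / a) * (a * √n / 100) := by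
        have : 100000 * (√m / a) * (a * √n / 100) = 1000 * (√m * √n) := by
          field_simp; ring
        rw [this]
        nlinarith [mul_nonneg (Real.sqrt_nonneg (m : ℝ)) hsn.le]
    _ ≤ _ := by gcongr

/-- The bound for the probability that clipping makes the rounding error long. The
factors `1` are the universal constants of the theorem. -/
def clipBound (K : ℝ) (n B : ℕ) : ℝ :=
  min (1 * (2 : ℝ) ^ (-(1 * ((n : ℝ) * (K * Real.log B) ^ 2 / (B : ℝ) ^ 4))))
    (2 * (n : ℝ) * (B : ℝ) ^ (-K))

lemma clipBound_nonneg (K : ℝ) (n B : ℕ) : 0 ≤ clipBound K n B := by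
  unfold clipBound; positivity

lemma one_le_lnPlus (t : ℝ) : 1 ≤ lnPlus t := le_max_right _ _

lemma log_le_lnPlus (t : ℝ) : Real.log t ≤ lnPlus t := le_max_left _ _

lemma rounding_error_long_le {r : ℝ → ℤ} (hr : IsNearestInteger r) {K : ℝ} (hK : 2 ≤ K) {B : ℕ}
    (hB : 1 ≤ B) {a : ℝ} (ha : 1 ≤ a) (haB : a ^ 2 * (4 * K * lnPlus B) = (B : ℝ) ^ 2) :
    stdGaussian (EuclideanSpace ℝ (Fin n)) {g | 9 * n < ‖roundedVec r B a g - a • g‖ ^ 2} ≤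
      ENNReal.ofReal (clipBound K n B) := by
  set L := lnPlus (B : ℝ)
  have hL1 : 1 ≤ L := one_le_lnPlus _
  have hLlog : Real.log B ≤ L := log_le_lnPlus _
  have hB0 : (0 : ℝ) < B := by exact_mod_cast hB
  have hlog0 : 0 ≤ Real.log B := Real.log_nonneg (by exact_mod_cast hB)
  have hn0 : (0 : ℝ) ≤ n := Nat.cast_nonneg n
  have ha0 : 0 < a := by linarith
  have hKL : 2 ≤ K * L := by nlinarith
  have hiff : ∀ x : ℝ, (B : ℝ) ^ 2 < (a * x) ^ 2 ↔ 4 * K * L < x ^ 2 := fun x => by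
    rw [← haB, mul_pow, mul_lt_mul_iff_right₀ (by positivity)]
  have hsum : ∀ g : EuclideanSpace ℝ (Fin n), ‖roundedVec r B a g - a • g‖ ^ 2 ≤
      n / 4 + a ^ 2 * ∑ i, if 4 * K * L < g i ^ 2 then g i ^ 2 else 0 := fun g => by
    refine (norm_roundedVec_sub_sq_le hr B a g).trans (le_of_eq ?_)
    rw [Finset.mul_sum]
    congr 1
    refine Finset.sum_congr rfl fun i _ => ?_
    rw [mul_ite, mul_zero, ← mul_pow]
    exact if_congr (hiff _) rfl rfl
  unfold clipBound
  rcases le_total (1 * (2 : ℝ) ^ (-(1 * ((n : ℝ) * (K * Real.log B) ^ 2 / (B : ℝ) ^ 4))))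
    (2 * (n : ℝ) * (B : ℝ) ^ (-K)) with hmin | hmin
  · rw [min_eq_left hmin]
    refine (measure_mono fun g hg => ?_).trans ((gaussian_truncated_sum_le (n := n)
      (s := 4 * K * L) (T := 4 * n / a ^ 2)).trans (ENNReal.ofReal_le_ofReal ?_))
    · have h1 : 9 * (n : ℝ) < ‖roundedVec r B a g - a • g‖ ^ 2 := hg
      change 4 * (n : ℝ) / a ^ 2 ≤ _
      rw [div_le_iff₀ (by positivity)]
      linarith [hsum g]
    · -- Here `x = 1 / (4 * a ^ 2) ≤ 1`, so that the bound `exp (-n * x)` may be weakened to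
      -- `exp (-n * x ^ 2)`.
      set x := K * L / (B : ℝ) ^ 2 with hx
      have hx4 : 1 / a ^ 2 = 4 * x := by
        rw [hx, ← haB]
        have : L ≠ 0 := by linarith
        have : K ≠ 0 := by linarith
        field_simp
      have hx1 : x ≤ 1 := by
        have : 1 / a ^ 2 ≤ 1 := by
          rw [div_le_one (by positivity)]; nlinarith
        linarith [show 0 ≤ x by positivity]
      have hexp : Real.exp (-(4 * K * L / 4)) ≤ 1 / (B : ℝ) ^ 2 := by
        rw [one_div, ← Real.exp_log (show (0 : ℝ) < B ^ 2 by positivity), ← Real.exp_neg,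
          Real.exp_le_exp, Real.log_pow]
        push_cast
        nlinarith
      have hexp2 : 2 * Real.exp (-(4 * K * L / 4)) ≤ x := by
        refine (mul_le_mul_of_nonneg_left hexp zero_le_two).trans ?_
        rw [hx, ← mul_div_assoc, mul_one]
        gcongr
      rw [one_mul, one_mul, Real.rpow_def_of_pos zero_lt_two, Real.exp_le_exp]
      have hT : 4 * (n : ℝ) / a ^ 2 / 8 = 2 * (n * x) := by
        rw [show 4 * (n : ℝ) / a ^ 2 / 8 = n / 2 * (1 / a ^ 2) by ring, hx4]; ring
      have hlhs : 2 * (n : ℝ) * Real.exp (-(4 * K * L / 4)) - 4 * n / a ^ 2 / 8 ≤ -(n * x) := by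
        rw [hT]
        nlinarith
      have hsq : (n : ℝ) * (K * Real.log B) ^ 2 / (B : ℝ) ^ 4 ≤ n * x := by
        have h1 : (K * Real.log B) ^ 2 ≤ (K * L) ^ 2 := by
          have : 0 ≤ K := by linarith
          gcongr
        have h2 : x ^ 2 ≤ x := by
          have : 0 ≤ x := by positivity
          nlinarith
        calc (n : ℝ) * (K * Real.log B) ^ 2 / (B : ℝ) ^ 4 ≤ n * (K * L) ^ 2 / (B : ℝ) ^ 4 := by
              gcongr
          _ = n * x ^ 2 := by rw [hx]; field_simp
          _ ≤ n * x := by gcongr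
      have hlog2 : Real.log 2 ≤ 1 := by linarith [Real.log_two_lt_d9]
      have hlog2' : 0 ≤ Real.log 2 := Real.log_nonneg one_le_two
      have hpos : 0 ≤ (n : ℝ) * (K * Real.log B) ^ 2 / (B : ℝ) ^ 4 := by positivity
      nlinarith
  · rw [min_eq_right hmin]
    refine (measure_mono fun g hg => ?_).trans ((gaussian_exists_large_le (n := n)
      (4 * K * L)).trans (ENNReal.ofReal_le_ofReal ?_))
    · have h1 : 9 * (n : ℝ) < ‖roundedVec r B a g - a • g‖ ^ 2 := hg
      change ∃ i, 4 * K * L < g i ^ 2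
      by_contra hcon
      push Not at hcon
      have h2 := hsum g
      rw [Finset.sum_eq_zero fun i _ => if_neg (not_lt.2 (hcon i))] at h2
      linarith
    · have : Real.exp (-(3 / 8 * (4 * K * L))) ≤ (B : ℝ) ^ (-K) := by
        rw [Real.rpow_def_of_pos hB0, Real.exp_le_exp]
        nlinarith
      calc (n : ℝ) * (2 * Real.exp (-(3 / 8 * (4 * K * L)))) ≤ n * (2 * (B : ℝ) ^ (-K)) := by
            gcongr
        _ = _ := by ring

/-- In terms of the kernel vector `p.2` before scaling by `a = B / √(4 K ln⁺ B)`: the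
rounded vector is nonzero, and the matrix with rows `p.1` maps it to a short vector. -/
def GoodRounding (r : ℝ → ℤ) (B : ℕ) (a : ℝ)
    (p : (Fin m → EuclideanSpace ℝ (Fin n)) × EuclideanSpace ℝ (Fin n)) : Prop :=
  0 < ‖roundedVec r B a p.2‖ ∧
    √(∑ i, ⟪p.1 i, roundedVec r B a p.2⟫ ^ 2) ≤ 100000 * (√m / a) * ‖roundedVec r B a p.2‖

lemma kernelVectorLaw_not_good_le_of_large (hmn : m < n) (hm : 0 < m) {r : ℝ → ℤ}
    (hr : IsNearestInteger r) {K : ℝ} (hK : 2 ≤ K) {B : ℕ} (hB : 1 ≤ B) {a : ℝ} (ha : 300 ≤ a)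
    (haB : a ^ 2 * (4 * K * lnPlus B) = (B : ℝ) ^ 2) :
    kernelVectorLaw m (EuclideanSpace ℝ (Fin n)) {p | ¬ GoodRounding r B a p} ≤
      ENNReal.ofReal ((1 / 2) ^ m + clipBound K n B) := by
  have hfin : m < Module.finrank ℝ (EuclideanSpace ℝ (Fin n)) := by simpa using hmn
  set J := kernelVectorLaw m (EuclideanSpace ℝ (Fin n))
  have hbm : Measurable fun g : EuclideanSpace ℝ (Fin n) => roundedVec r B a g - a • g :=
    (measurable_roundedVec hr B a).sub (by fun_prop)
  set F : Set ((Fin m → EuclideanSpace ℝ (Fin n)) × EuclideanSpace ℝ (Fin n)) :=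
    {p | p.2 ∈ Set.univ ∧ 16 * m * 5461 * ‖roundedVec r B a p.2 - a • p.2‖ ^ 2 <
      ∑ i, ⟪p.1 i, roundedVec r B a p.2 - a • p.2⟫ ^ 2} with hF
  set G : Set (EuclideanSpace ℝ (Fin n)) :=
    {g | 9 * n < ‖roundedVec r B a g - a • g‖ ^ 2} with hG
  have hGm : MeasurableSet G := measurableSet_lt measurable_const (hbm.norm.pow_const 2)
  set H : Set (EuclideanSpace ℝ (Fin n)) := {g | ‖g‖ ^ 2 ≤ n / 2500} with hH
  have hHm : MeasurableSet H := measurableSet_le (by fun_prop) (by fun_prop)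
  have hsub : J {p | ¬ GoodRounding r B a p} ≤ J (F ∪ ({p | p.2 ∈ H} ∪ {p | p.2 ∈ G})) := by
    refine measure_mono_ae (kernelVectorLaw_inner_ae.mono fun p hp hbad => ?_)
    change p ∈ F ∪ ({p | p.2 ∈ H} ∪ {p | p.2 ∈ G})
    by_contra hcon
    simp only [Set.mem_union, not_or] at hcon
    obtain ⟨h1, h2, h3⟩ := hcon
    have h1' := not_lt.1 fun h => h1 ⟨Set.mem_univ _, h⟩
    have h4 : ∀ i, ⟪p.1 i, roundedVec r B a p.2 - a • p.2⟫ =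
        ⟪p.1 i, roundedVec r B a p.2⟫ := fun i => by
      rw [inner_sub_right, real_inner_smul_right, hp i, mul_zero, sub_zero]
    simp only [h4] at h1'
    exact hbad (sqrt_le_of_le_scale ha (by omega) (not_lt.1 h3) (not_le.1 h2) h1')
  have h1 : J F ≤ ENNReal.ofReal ((1 / 4) ^ m) := by
    have h := kernelVectorLaw_stretch_euclidean_le hmn hbm MeasurableSet.univ
    rwa [measure_univ, mul_one] at h
  have h2 : J {p | p.2 ∈ H} ≤ ENNReal.ofReal ((1 / 16) ^ n) :=
    (kernelVectorLaw_snd hfin hHm).le.trans gaussian_norm_small_le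
  have h3 : J {p | p.2 ∈ G} ≤ ENNReal.ofReal (clipBound K n B) :=
    (kernelVectorLaw_snd hfin hGm).le.trans
      (rounding_error_long_le hr hK hB (by linarith) haB)
  refine hsub.trans ((measure_union_le _ _).trans ((add_le_add h1 ((measure_union_le _ _).trans
    (add_le_add h2 h3))).trans ?_))
  rw [← ENNReal.ofReal_add (by positivity) (clipBound_nonneg K n B),
    ← ENNReal.ofReal_add (by positivity) (add_nonneg (by positivity) (clipBound_nonneg K n B))]
  refine ENNReal.ofReal_le_ofReal ?_
  have h4 : ((1 : ℝ) / 16) ^ n ≤ (1 / 16) ^ m :=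
    pow_le_pow_of_le_one (by norm_num) (by norm_num) hmn.le
  have h5 : ((1 : ℝ) / 16) ^ m ≤ (1 / 4) ^ m := by gcongr; norm_num
  have h6 : ((1 : ℝ) / 4) ^ m = (1 / 2) ^ m * (1 / 2) ^ m := by rw [← mul_pow]; norm_num
  have h7 : ((1 : ℝ) / 2) ^ m ≤ 1 / 2 := pow_le_of_le_one (by norm_num) (by norm_num) hm.ne'
  have h8 : (0 : ℝ) < (1 / 2) ^ m := by positivity
  nlinarith

lemma kernelVectorLaw_stretched_le_of_small (hmn : m < n) {r : ℝ → ℤ}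
    (hr : IsNearestInteger r) {B : ℕ} {a : ℝ} (ha : 0 < a) (ha' : a < 300) :
    kernelVectorLaw m (EuclideanSpace ℝ (Fin n))
      {p | ¬ √(∑ i, ⟪p.1 i, roundedVec r B a p.2⟫ ^ 2) ≤
        100000 * (√m / a) * ‖roundedVec r B a p.2‖} ≤ ENNReal.ofReal ((1 / 2) ^ m) := by
  refine (measure_mono fun p hp => ?_).trans ((kernelVectorLaw_stretch_euclidean_le hmn
    (measurable_roundedVec hr B a) MeasurableSet.univ).trans ?_)
  · refine ⟨Set.mem_univ _, not_le.1 fun h => hp ?_⟩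
    exact sqrt_le_of_scale_lt ha ha' (norm_nonneg _) h
  · rw [measure_univ, mul_one]
    refine ENNReal.ofReal_le_ofReal ?_
    gcongr
    norm_num

/-- If one of two independent events happens with probability `p ^ m` and the other one with
probability `q ^ m`, their union is at most as likely as `m` successes in a row, each of
probability `p + q - p * q`. -/
lemma pow_union_le {p q : ℝ} (hp : 0 ≤ p) (hp1 : p ≤ 1) (hq : 0 ≤ q) (hq1 : q ≤ 1) (m : ℕ) :
    p ^ m + q ^ m - p ^ m * q ^ m ≤ (p + q - p * q) ^ m := by
  induction m with
  | zero => simp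
  | succ k ih =>
    have h1 : 0 ≤ p + q - p * q := by nlinarith
    have h2 : p ^ k ≤ 1 := pow_le_one₀ hp hp1
    have h3 : q ^ k ≤ 1 := pow_le_one₀ hq hq1
    have h4 : 0 ≤ p ^ k := pow_nonneg hp k
    have h5 : 0 ≤ q ^ k := pow_nonneg hq k
    rw [pow_succ, pow_succ, pow_succ]
    refine le_trans ?_ (mul_le_mul_of_nonneg_right ih h1)
    have h6 : 0 ≤ p * (1 - q) * (q ^ k * (1 - p ^ k)) := by
      apply mul_nonneg (mul_nonneg hp (by linarith)) (mul_nonneg h5 (by linarith))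
    have h7 : 0 ≤ q * (1 - p) * (p ^ k * (1 - q ^ k)) := by
      apply mul_nonneg (mul_nonneg hq (by linarith)) (mul_nonneg h4 (by linarith))
    nlinarith

/-- For a small scaling factor the rounded vector may vanish; the conditional form of the bound
on the stretch keeps the probability of failure exponentially small even if rounding to zero is
likely. -/
lemma kernelVectorLaw_not_good_le_of_small (hmn : m < n) {r : ℝ → ℤ} (hr : IsNearestInteger r)
    {B : ℕ} (hB : 1 ≤ B) {a s : ℝ} (ha : 0 < a) (ha' : a < 300) (has : 1 / (2 * a) ≤ s) {p : ℝ}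
    (hp0 : 0 ≤ p) (hp1 : p ≤ 1) (hp : gaussianReal 0 1 (Set.Icc (-s) s) ≤ ENNReal.ofReal p) :
    kernelVectorLaw m (EuclideanSpace ℝ (Fin n)) {x | ¬ GoodRounding r B a x} ≤
      ENNReal.ofReal ((p + 1 / 4 - p * (1 / 4)) ^ m) := by
  have hfin : m < Module.finrank ℝ (EuclideanSpace ℝ (Fin n)) := by simpa using hmn
  set J := kernelVectorLaw m (EuclideanSpace ℝ (Fin n))
  set Z : Set (EuclideanSpace ℝ (Fin n)) := {g | roundedVec r B a g = 0} with hZ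
  have hZm : MeasurableSet Z := measurable_roundedVec hr B a (measurableSet_singleton 0)
  set F : Set ((Fin m → EuclideanSpace ℝ (Fin n)) × EuclideanSpace ℝ (Fin n)) :=
    {p | p.2 ∈ Zᶜ ∧ 16 * m * 5461 * ‖roundedVec r B a p.2‖ ^ 2 <
      ∑ i, ⟪p.1 i, roundedVec r B a p.2⟫ ^ 2} with hF
  have hsub : {x | ¬ GoodRounding r B a x} ⊆ {x | x.2 ∈ Z} ∪ F := by
    intro x hx
    by_contra hcon
    simp only [Set.mem_union, not_or] at hcon
    have h1 : 0 < ‖roundedVec r B a x.2‖ := norm_pos_iff.2 hcon.1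
    refine hx ⟨h1, sqrt_le_of_scale_lt ha ha' h1.le (not_lt.1 fun h => hcon.2 ⟨hcon.1, h⟩)⟩
  have hZp : stdGaussian (EuclideanSpace ℝ (Fin n)) Z ≤ ENNReal.ofReal (p ^ m) := by
    have h1 : Z ⊆ {g | ∀ i, g i ∈ Set.Icc (-s) s} := by
      intro g hg i
      have h2 : clipRound r B (a * g i) = 0 := by
        have := congrArg (fun v : EuclideanSpace ℝ (Fin n) => v i)
          (show roundedVec r B a g = 0 from hg)
        simpa [roundedVec] using this
      have h3 := abs_le_of_clipRound_eq_zero hr hB h2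
      rw [abs_mul, abs_of_pos ha] at h3
      refine abs_le.1 (le_trans ?_ has)
      rw [le_div_iff₀ (by positivity)]
      linarith
    refine (measure_mono h1).trans ((gaussian_all_small s).le.trans ?_)
    refine (pow_le_pow_left' hp n).trans ?_
    rw [← ENNReal.ofReal_pow hp0]
    exact ENNReal.ofReal_le_ofReal (pow_le_pow_of_le_one hp0 hp1 hmn.le)
  set x := (stdGaussian (EuclideanSpace ℝ (Fin n))).real Z with hx
  have hxZ : stdGaussian (EuclideanSpace ℝ (Fin n)) Z = ENNReal.ofReal x :=
    (ofReal_measureReal).symm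
  have hxZc : stdGaussian (EuclideanSpace ℝ (Fin n)) Zᶜ = ENNReal.ofReal (1 - x) := by
    rw [← ofReal_measureReal, probReal_compl_eq_one_sub hZm]
  have hx0 : 0 ≤ x := measureReal_nonneg
  have hx1 : x ≤ 1 := measureReal_le_one
  have hxp : x ≤ p ^ m := by
    rw [hxZ] at hZp
    exact (ENNReal.ofReal_le_ofReal_iff (pow_nonneg hp0 m)).1 hZp
  refine (measure_mono hsub).trans ((measure_union_le _ _).trans ((add_le_add
    (kernelVectorLaw_snd hfin hZm).le (kernelVectorLaw_stretch_euclidean_le hmn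
      (measurable_roundedVec hr B a) hZm.compl)).trans ?_))
  rw [hxZ, hxZc, ← ENNReal.ofReal_mul (by positivity), ← ENNReal.ofReal_add hx0
    (mul_nonneg (by positivity) (by linarith))]
  refine ENNReal.ofReal_le_ofReal ?_
  have h1 : ((1 : ℝ) / 4) ^ m ≤ 1 := pow_le_one₀ (by norm_num) (by norm_num)
  have h2 := pow_union_le hp0 hp1 (q := 1 / 4) (by norm_num) (by norm_num) m
  nlinarith

end Failure

/-! ### The guarantee of the algorithm -/

lemma vecNorm_eq {n : ℕ} (z : Fin n → ℤ) :
    vecNorm z = ‖(WithLp.toLp 2 fun i => (z i : ℝ) : EuclideanSpace ℝ (Fin n))‖ := by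
  rw [EuclideanSpace.norm_eq, vecNorm]
  simp

lemma imageNorm_eq {m n : ℕ} (A : Fin m → Fin n → ℝ) (z : Fin n → ℤ) :
    imageNorm A z = √(∑ i, inner ℝ (euclideanRows A i)
      (WithLp.toLp 2 fun i => (z i : ℝ) : EuclideanSpace ℝ (Fin n)) ^ 2) := by
  simp only [imageNorm, inner_euclideanRows]

lemma kernelRoundProb_le_one {m n : ℕ} (hmn : m < n) (r : ℝ → ℤ) (K : ℝ) (B : ℕ)
    (bad : (Fin m → Fin n → ℝ) → (Fin n → ℤ) → Prop) : kernelRoundProb r K B bad ≤ 1 :=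
  (kernelRoundProb_le hmn MeasurableSet.univ fun _ _ _ => Set.mem_univ _).trans prob_le_one

end

theorem theorem4p5 :
    ∃ C C' c : ℝ, 0 < C ∧ 0 < C' ∧ 0 < c ∧ ∀ K : ℝ, 2 ≤ K → ∃ cK : ℝ, 0 < cK ∧
      ∀ (m n B : ℕ), m < n → 1 ≤ B → ∀ r : ℝ → ℤ, IsNearestInteger r →
        (∀ (A : Fin m → Fin n → ℝ) (w : ℝ × Metric.sphere (0 : kerSpace A) 1) (i : Fin n),
          |kernelRound r K B A w i| ≤ (B : ℤ)) ∧
        kernelRoundProb r K B (fun (A : Fin m → Fin n → ℝ) (z : Fin n → ℤ) =>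
            ¬ imageNorm A z ≤ C * (√((m : ℝ) * K * lnPlus B) / (B : ℝ)) * vecNorm z) ≤
          ENNReal.ofReal ((2 : ℝ) ^ (-(c * (m : ℝ))) +
            min (C' * (2 : ℝ) ^ (-(c * ((n : ℝ) * (K * Real.log B) ^ 2 / (B : ℝ) ^ 4))))
              (2 * (n : ℝ) * (B : ℝ) ^ (-K))) ∧
        kernelRoundProb r K B (fun (A : Fin m → Fin n → ℝ) (z : Fin n → ℤ) =>
            ¬ (z ≠ 0 ∧
              imageNorm A z / vecNorm z ≤ C * (√((m : ℝ) * K * lnPlus B) / (B : ℝ)))) ≤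
          ENNReal.ofReal ((2 : ℝ) ^ (-(cK * (m : ℝ))) +
            min (C' * (2 : ℝ) ^ (-(c * ((n : ℝ) * (K * Real.log B) ^ 2 / (B : ℝ) ^ 4))))
              (2 * (n : ℝ) * (B : ℝ) ^ (-K))) := by
  refine ⟨200000, 1, 1, by norm_num, one_pos, one_pos, fun K hK => ?_⟩
  set p : ℝ := (gaussianReal 0 1).real (Set.Icc (-√K) √K) with hp
  have hp0 : 0 ≤ p := measureReal_nonneg
  have hp1 : p < 1 := by
    have := (ENNReal.toReal_lt_toReal (measure_ne_top _ _) ENNReal.one_ne_top).2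
      (gaussianReal_Icc_lt_one √K)
    simpa [hp, Measure.real] using this
  have hpG : gaussianReal 0 1 (Set.Icc (-√K) √K) ≤ ENNReal.ofReal p := by
    rw [hp, ofReal_measureReal]
  set ρ : ℝ := max (p + 1 / 4 - p * (1 / 4)) (1 / 2) with hρ
  have hρ1 : ρ < 1 := max_lt (by linarith) (by norm_num)
  have hρ2 : 1 / 2 ≤ ρ := le_max_right _ _
  have hρ0 : 0 < ρ := by linarith
  have hpow : ∀ m : ℕ, (2 : ℝ) ^ (-(-Real.logb 2 ρ * (m : ℝ))) = ρ ^ m := fun m => by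
    rw [neg_mul, neg_neg, Real.rpow_mul zero_le_two,
      Real.rpow_logb zero_lt_two (by norm_num) hρ0, Real.rpow_natCast]
  refine ⟨-Real.logb 2 ρ, neg_pos.2 (Real.logb_neg one_lt_two hρ0 hρ1), ?_⟩
  intro m n B hmn hB r hr
  refine ⟨fun A w i => abs_clipRound_le hr B _, ?_⟩
  rw [hpow, one_mul (m : ℝ), Real.rpow_neg zero_le_two, Real.rpow_natCast, ← inv_pow, ← one_div]
  change _ ≤ ENNReal.ofReal (_ + clipBound K n B) ∧ _ ≤ ENNReal.ofReal (_ + clipBound K n B)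
  have hclip := clipBound_nonneg K n B
  rcases Nat.eq_zero_or_pos m with rfl | hm
  · have h1 : ∀ x : ℝ, 1 ≤ ENNReal.ofReal (x ^ 0 + clipBound K n B) := fun x => by
      rw [← ENNReal.ofReal_one, pow_zero]
      exact ENNReal.ofReal_le_ofReal (by linarith)
    exact ⟨(kernelRoundProb_le_one hmn r K B _).trans (h1 _),
      (kernelRoundProb_le_one hmn r K B _).trans (h1 _)⟩
  have hB0 : (0 : ℝ) < B := by exact_mod_cast hB
  set L := lnPlus (B : ℝ) with hL
  have hL1 : 1 ≤ L := one_le_lnPlus _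
  have hKL : 0 < 4 * K * L := by nlinarith
  set a : ℝ := (B : ℝ) / √(4 * K * L) with ha
  have hs : 0 < √(4 * K * L) := Real.sqrt_pos.2 hKL
  have ha0 : 0 < a := by positivity
  have haB : a ^ 2 * (4 * K * L) = (B : ℝ) ^ 2 := by
    rw [ha, div_pow, Real.sq_sqrt hKL.le, div_mul_cancel₀ _ hKL.ne']
  have hsqrt : √(4 * K * L) = 2 * √(K * L) := by
    rw [show 4 * K * L = 2 ^ 2 * (K * L) by ring, Real.sqrt_mul (by norm_num),
      Real.sqrt_sq (by norm_num)]
  -- The bound of the theorem is of order `√m / a`, since `√(K * L) / B = 1 / (2 * a)`.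
  have hbound : 200000 * (√((m : ℝ) * K * L) / (B : ℝ)) = 100000 * (√m / a) := by
    rw [ha, hsqrt, show (m : ℝ) * K * L = m * (K * L) by ring, Real.sqrt_mul (Nat.cast_nonneg m)]
    field_simp
    ring
  -- A coordinate of the kernel vector that is rounded to zero is at most `1 / (2 * a)`.
  have has : 1 / (2 * a) ≤ √K := by
    have hLB : L ≤ (B : ℝ) ^ 2 := by
      have h1 : (1 : ℝ) ≤ B := by exact_mod_cast hB
      refine max_le ?_ (by nlinarith)
      have := Real.log_le_sub_one_of_pos hB0
      nlinarith
    have h2 : 1 / (2 * a) = √(K * L) / B := by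
      rw [ha, hsqrt]; field_simp
    rw [h2, div_le_iff₀ hB0]
    refine (Real.sqrt_le_sqrt (mul_le_mul_of_nonneg_left hLB (by linarith))).trans ?_
    rw [Real.sqrt_mul (by linarith), Real.sqrt_sq hB0.le]
  have hrm := measurable_roundedVec (n := n) hr B a
  have hrm' : Measurable fun x : (Fin m → EuclideanSpace ℝ (Fin n)) × EuclideanSpace ℝ (Fin n) =>
      roundedVec r B a x.2 := hrm.comp measurable_snd
  have hnm : Measurable fun x : (Fin m → EuclideanSpace ℝ (Fin n)) × EuclideanSpace ℝ (Fin n) =>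
      √(∑ i, inner ℝ (x.1 i) (roundedVec r B a x.2) ^ 2) := by
    have h : ∀ i, Measurable fun x : (Fin m → EuclideanSpace ℝ (Fin n)) ×
      EuclideanSpace ℝ (Fin n) => x.1 i := fun i => by fun_prop
    exact (Finset.measurable_sum _ fun i _ => ((h i).inner hrm').pow_const 2).sqrt
  have hT1m : MeasurableSet {x : (Fin m → EuclideanSpace ℝ (Fin n)) × EuclideanSpace ℝ (Fin n) |
      √(∑ i, inner ℝ (x.1 i) (roundedVec r B a x.2) ^ 2) ≤
        100000 * (√m / a) * ‖roundedVec r B a x.2‖} :=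
    measurableSet_le hnm (hrm'.norm.const_mul _)
  have hT2m : MeasurableSet {x : (Fin m → EuclideanSpace ℝ (Fin n)) × EuclideanSpace ℝ (Fin n) |
      GoodRounding r B a x} := (measurableSet_lt measurable_const hrm'.norm).inter hT1m
  have hP1 := kernelRoundProb_le (r := r) (K := K) (B := B)
    (bad := fun (A : Fin m → Fin n → ℝ) (z : Fin n → ℤ) =>
      ¬ imageNorm A z ≤ 200000 * (√((m : ℝ) * K * L) / (B : ℝ)) * vecNorm z) hmn hT1m.compl
    (fun A g hbad => by
      rw [hbound, vecNorm_eq, imageNorm_eq] at hbad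
      exact hbad)
  have hP2 := kernelRoundProb_le (r := r) (K := K) (B := B)
    (bad := fun (A : Fin m → Fin n → ℝ) (z : Fin n → ℤ) =>
      ¬ (z ≠ 0 ∧ imageNorm A z / vecNorm z ≤ 200000 * (√((m : ℝ) * K * L) / (B : ℝ))))
    hmn hT2m.compl
    (fun A g hbad hgood => hbad (by
      rw [hbound, vecNorm_eq, imageNorm_eq]
      refine ⟨fun h0 => ?_, (div_le_iff₀ hgood.1).2 hgood.2⟩
      have h1 : roundedVec r B a g = 0 := by
        ext i
        have h2 : clipRound r B (a * g i) = 0 := congrFun h0 i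
        simp [roundedVec, h2]
      have h3 := hgood.1
      simp [h1] at h3))
  rcases lt_or_ge a 300 with hsmall | hlarge
  · refine ⟨hP1.trans ((kernelVectorLaw_stretched_le_of_small hmn hr ha0 hsmall).trans
      (ENNReal.ofReal_le_ofReal (by linarith))), hP2.trans
      ((kernelVectorLaw_not_good_le_of_small hmn hr hB ha0 hsmall has hp0 hp1.le hpG).trans
      (ENNReal.ofReal_le_ofReal ?_))⟩
    have : (p + 1 / 4 - p * (1 / 4)) ^ m ≤ ρ ^ m :=
      pow_le_pow_left₀ (by linarith) (le_max_left _ _) m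
    linarith
  · have h := kernelVectorLaw_not_good_le_of_large hmn hm hr hK hB hlarge haB
    refine ⟨hP1.trans (le_trans (measure_mono ?_) h),
      hP2.trans (h.trans (ENNReal.ofReal_le_ofReal ?_))⟩
    · intro x hx hgood
      exact hx hgood.2
    have : ((1 : ℝ) / 2) ^ m ≤ ρ ^ m := pow_le_pow_left₀ (by norm_num) hρ2 m
    linarith
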